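/- We work in Markov's constructive analysis. "Algorithm" means partial recursive function (equivalently, normal algorithm) and "computable" means total recursive. A constructive real number $x$ is given by a code: a pair of programs for a sequence $(a_i)$ of rational numbers with $a_i\to x$ and for a regulator $b:\mathbb N\to\mathbb N$ with $|a_i-a_j|<2^{-n}$ for all $i,j\ge b(n)$. All points $x\in[0,1]$ below are constructive. A constructive function $f:[0,1]\to\mathbb R$ is one for which some algorithm transforms every code of every point $x\in[0,1]$ into a code of $f(x)$. A polygonal function is the piecewise linear interpolant of a finite list $(p_0,q_0),\dots,(p_m,q_m)$ of pairs of rational numbers with $0=p_0<p_1<\dots<p_m=1$, and its integral is $\sum_{k=1}^m (q_k+q_{k-1})(p_k-p_{k-1})/2$; algorithms handle it as this list. A function $f:[0,1]\to\mathbb R$ is Darboux integrable if some algorithm transforms every code of every constructive real number $\varepsilon>0$ into two polygonal functions $f^\downarrow,f^\uparrow$ with $f^\downarrow(x)\le f(x)\le f^\uparrow(x)$ for all $x\in[0,1]$ and $\int_0^1(f^\uparrow-f^\downarrow)<\varepsilon$. Let $(\mathfrak A_N)_{N\in\mathbb N}$ be any numbering of the algorithms that take a natural number and, if they halt, return a rational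 number $\delta$ and a finite list of pairs of rational numbers; that is, $(N,n)\mapsto\mathfrak A_N(n)$ is partial recursive, and every partial recursive function of this kind is some $\mathfrak A_N$. Consider the following data. 1. $\mu:\mathbb N\to\mathbb N$ is a computable injection whose range is the set of all $N$ for which $\mathfrak A_N(N)$ halts with a result consisting of a rational number $\delta>0$ and a nonnegative polygonal function $g$ with $\int_0^1 g<1/2$; $(\delta_n,g_n)$ is the result of $\mathfrak A_{\mu(n)}(\mu(n))$. 2. $(h_n)$ is a computable nondecreasing sequence of nonnegative polygonal functions with $\int_0^1 h_n<1/2$ for all $n$ and $\lim_{n\to\infty}h_n(x)=2$ for every $x\in[0,1]$. 3. $\nu:\mathbb N\to\mathbb N$ is computable and strictly increasing, and $(\zeta_n)$, $(\beta_n)$ are computable sequences of rational numbers with $0<\zeta_n<1$ and $0<\beta_n<\min(\delta_n,\zeta_n,1-\zeta_n)$, such that $g_n(x)+h_{\nu(n)}(x)<1<h_{\nu(n+1)}(x)$ for all $n$ and all $x\in[\zeta_n-\beta_n,\zeta_n+\beta_n]$. Then such data exist. Moreover, for every choice of such data, the series $$f(x)=\sum_{n=0}^\infty 2^{-\mu(n)}\max\Bigl(0,\,1-\frac{|x-\zeta_n|}{\beta_n}\Bigr)$$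 converges at every $x\in[0,1]$ and defines a constructive function $f:[0,1]\to\mathbb R$ that is not Darboux integrable. -/

import Mathlib

open Set Filter Topology

/-! Constructive (recursive) analysis on the unit interval. "Algorithm" means partial recursive
function; constructive objects are given to algorithms, and returned by them, as codes. -/

namespace MarkovAnalysis

/-- The code `(a, b, c)` of the rational number `(a - b) / (c + 1)`. -/
abbrev RatCode : Type := ℕ × ℕ × ℕ

/-- The rational number with a given code; every rational number has a code. -/
def RatCode.val (r : RatCode) : ℚ := ((r.1 : ℚ) - (r.2.1 : ℚ)) / ((r.2.2 : ℚ) + 1)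

/-- A code of a constructive real number: a program for a sequence of rational numbers and a
program for a regulator of its convergence. -/
abbrev RealCode : Type := Nat.Partrec.Code × Nat.Partrec.Code

/-- `c` is a code of the constructive real number `x`: its first program computes a total sequence
`a` of rational numbers converging to `x`, its second program computes a total sequence `b` of
natural numbers with `|a i - a j| < 2⁻ⁿ` for all `i, j ≥ b n`. -/
def RealCode.Represents (c : RealCode) (x : ℝ) : Prop :=
  ∃ (a : ℕ → RatCode) (b : ℕ → ℕ),
    (∀ n, Encodable.encode (a n) ∈ c.1.eval n) ∧
    (∀ n, b n ∈ c.2.eval n) ∧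
    (∀ n i j, b n ≤ i → b n ≤ j → |(a i).val - (a j).val| < (1 / 2 : ℚ) ^ n) ∧
    Tendsto (fun i => ((a i).val : ℝ)) atTop (𝓝 x)

/-- The constructive points of `[0, 1]`. -/
def UnitPoint : Type := {x : ℝ // x ∈ Icc (0 : ℝ) 1 ∧ ∃ c : RealCode, c.Represents x}

/-- `f` is a constructive function `[0, 1] → ℝ`: some algorithm transforms every code of every
constructive point `x` of `[0, 1]` into a code of the real number `f x`. -/
def IsConstructiveFunction (f : UnitPoint → ℝ) : Prop :=
  ∃ F : RealCode →. RealCode, Partrec F ∧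
    ∀ (c : RealCode) (x : UnitPoint), c.Represents x.1 →
      ∃ d ∈ F c, RealCode.Represents d (f x)

/-- The code of a polygonal function: the list of its vertices `(p₀, q₀), …, (pₘ, qₘ)`. -/
abbrev PolyCode : Type := List (RatCode × RatCode)

/-- The list is the vertex list of a polygonal function on `[0, 1]`:
`0 = p₀ < p₁ < ⋯ < pₘ = 1`. -/
def PolyCode.IsPolygonal (L : PolyCode) : Prop :=
  (L.map fun v => v.1.val).head? = some 0 ∧
  (L.map fun v => v.1.val).getLast? = some 1 ∧
  (L.map fun v => v.1.val).Pairwise (· < ·)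

/-- The value at `x` of the polygonal function with given vertices: linear interpolation between
consecutive vertices. -/
noncomputable def PolyCode.eval : PolyCode → ℝ → ℝ
  | v :: w :: L, x =>
      if x ≤ (w.1.val : ℝ) then
        ((w.2.val : ℝ) * (x - (v.1.val : ℝ)) + (v.2.val : ℝ) * ((w.1.val : ℝ) - x)) /
          ((w.1.val : ℝ) - (v.1.val : ℝ))
      else PolyCode.eval (w :: L) x
  | _, _ => 0

/-- The polygonal integral `∑ₖ (qₖ + qₖ₋₁) (pₖ - pₖ₋₁) / 2`. -/
def PolyCode.integral : PolyCode → ℚ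
  | v :: w :: L =>
      (w.2.val + v.2.val) * (w.1.val - v.1.val) / 2 + PolyCode.integral (w :: L)
  | _ => 0

/-- Constructive Darboux integrability: some algorithm transforms every code of every constructive
real number `ε > 0` into a pair of polygonal functions `D ≤ f ≤ U` on the constructive points of
`[0, 1]` such that the integral of `U - D` is less than `ε`. -/
def DarbouxIntegrable (f : UnitPoint → ℝ) : Prop :=
  ∃ φ : RealCode →. PolyCode × PolyCode, Partrec φ ∧
    ∀ (c : RealCode) (ε : ℝ), c.Represents ε → 0 < ε →
      ∃ D U : PolyCode, (D, U) ∈ φ c ∧ D.IsPolygonal ∧ U.IsPolygonal ∧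
        (∀ x : UnitPoint, D.eval x.1 ≤ f x ∧ f x ≤ U.eval x.1) ∧
        ((U.integral - D.integral : ℚ) : ℝ) < ε

/-- The data `δ, (p₀, q₀), …, (pₘ, qₘ)` returned by an algorithm of the numbering below. -/
abbrev Output : Type := RatCode × PolyCode

/-- The data `(δ, g)` consist of a positive rational number `δ` and a nonnegative polygonal
function `g` whose integral is less than `1/2`. -/
def Output.Admissible (o : Output) : Prop :=
  0 < o.1.val ∧ o.2.IsPolygonal ∧ (∀ x : UnitPoint, 0 ≤ o.2.eval x.1) ∧ o.2.integral < 1 / 2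

/-- `A 0, A 1, …` is an (effective) numbering of all algorithms that take a natural number and
return, if they halt, a finite list of rational numbers of the form above. -/
def IsNumbering (A : ℕ → ℕ →. Output) : Prop :=
  Partrec₂ A ∧ ∀ φ : ℕ →. Output, Partrec φ → ∃ N, A N = φ

/-- One way of carrying out the construction of the function `f` from a numbering `A`. -/
structure Construction (A : ℕ → ℕ →. Output) where
  /-- An algorithmic enumeration without repetitions of the indices `N` for which `A N`, applied to
  `N`, halts with an admissible result. -/
  μ : ℕ → ℕ
  μ_computable : Computable μ
  μ_injective : Function.Injective μ
  μ_range : range μ = {N | ∃ o ∈ A N N, Output.Admissible o}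
  /-- The results `(δₙ, gₙ)` of the computations so enumerated. -/
  δ : ℕ → RatCode
  g : ℕ → PolyCode
  result : ∀ n, (δ n, g n) ∈ A (μ n) (μ n)
  /-- A nondecreasing sequence of nonnegative polygonal functions with integrals less than `1/2`
  that converges to `2` at every constructive point of `[0, 1]`. -/
  h : ℕ → PolyCode
  h_computable : Computable h
  h_polygonal : ∀ n, (h n).IsPolygonal
  h_nonneg : ∀ n (x : UnitPoint), 0 ≤ (h n).eval x.1
  h_mono : ∀ n (x : UnitPoint), (h n).eval x.1 ≤ (h (n + 1)).eval x.1
  h_tendsto : ∀ x : UnitPoint, Tendsto (fun n => (h n).eval x.1) atTop (𝓝 2)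
  h_integral : ∀ n, (h n).integral < 1 / 2
  /-- An increasing sequence of indices. -/
  ν : ℕ → ℕ
  ν_computable : Computable ν
  ν_strictMono : StrictMono ν
  /-- The centres and the half-widths of the bumps. -/
  ζ : ℕ → RatCode
  ζ_computable : Computable ζ
  ζ_mem : ∀ n, (ζ n).val ∈ Ioo (0 : ℚ) 1
  β : ℕ → RatCode
  β_computable : Computable β
  β_pos : ∀ n, 0 < (β n).val
  β_lt : ∀ n, (β n).val < min (δ n).val (min (ζ n).val (1 - (ζ n).val))
  separation : ∀ n (x : UnitPoint),
    x.1 ∈ Icc (((ζ n).val - (β n).val : ℚ) : ℝ) (((ζ n).val + (β n).val : ℚ) : ℝ) →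
      (g n).eval x.1 + (h (ν n)).eval x.1 < 1 ∧ 1 < (h (ν (n + 1))).eval x.1

/-- The bump `fₙ(x) = 2^(-μ(n)) · sup(0, 1 - |x - ζₙ| / βₙ)`. -/
noncomputable def Construction.bump {A : ℕ → ℕ →. Output} (C : Construction A) (n : ℕ)
    (x : ℝ) : ℝ :=
  (1 / 2 : ℝ) ^ C.μ n * max 0 (1 - |x - ((C.ζ n).val : ℝ)| / ((C.β n).val : ℝ))

end MarkovAnalysis

/-! Non-integrability is a diagonal argument. Suppose an algorithm produces polygonal bounds D ≤ f ≤
U of arbitrarily small gap. From N, request a gap below 2^-(N+3), let δ be a length over which D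
varies by at most 2^-N/4, and let g be a polygonal approximation of 2^(N+1)(U - D); its integral is
below 1/2 (`exists_primrec_rescaled_gap`). This procedure is itself some algorithm of the numbering;
run on its own index N it returns an admissible (δ, g), so N = μ(n) for some n. The n-th bump has
height 2^-N at ζ_n and falls to 0 within β_n < δ. Hence U ≥ 2^-N and D ≤ 2^-N/4 at ζ_n, which forces
g(ζ_n) > 1, against the requirement g_n + h_{ν(n)} < 1 at ζ_n.

The series still defines a constructive function because the h_n locate it. The n-th bump lives
where h_{ν(n)} < 1, so h_m(x) > 1 certifies that only bumps with index below m can be nonzero at x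
(`bump_eq_zero_of_one_lt`). As h_m(x) tends to 2, an algorithm finds such an m from any code of x
and evaluates a finite sum with a computable Lipschitz constant.

Existence rests on the singular covering of the constructive line: all constructive points of [0, 1]
lie in a computable sequence of intervals of small total length (`exists_singular_cover`), and
raising a polygonal function to 2 on these intervals one after another yields the h_n. Since g_n and
h_{ν(n)} each have integral below 1/2, their sum is below 1 at some rational ζ_n; Lipschitz
constants turn all requirements on (ζ_n, β_n, ν(n+1)) into decidable ones with a solution, so a
search finds them. -/

namespace MarkovAnalysis

/-! ### Rational arithmetic on codes -/

namespace RatCode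

def ofNat (n : ℕ) : RatCode := (n, 0, 0)

/-- The last entry of a code is the denominator minus one, hence the final `- 1`, which never
truncates. -/
def add (r s : RatCode) : RatCode :=
  (r.1 * (s.2.2 + 1) + s.1 * (r.2.2 + 1), r.2.1 * (s.2.2 + 1) + s.2.1 * (r.2.2 + 1),
    (r.2.2 + 1) * (s.2.2 + 1) - 1)

def neg (r : RatCode) : RatCode := (r.2.1, r.1, r.2.2)

def mul (r s : RatCode) : RatCode :=
  (r.1 * s.1 + r.2.1 * s.2.1, r.1 * s.2.1 + r.2.1 * s.1, (r.2.2 + 1) * (s.2.2 + 1) - 1)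

/-- A denominator is always positive, so the sign of the numerator decides which of the first two
entries receives the old denominator. Zero is sent to zero, matching the convention for `⁻¹` on `ℚ`.
-/
def inv (r : RatCode) : RatCode :=
  if r.2.1 < r.1 then (r.2.2 + 1, 0, r.1 - r.2.1 - 1)
  else if r.1 < r.2.1 then (0, r.2.2 + 1, r.2.1 - r.1 - 1)
  else (0, 0, 0)

theorem val_ofNat (n : ℕ) : (ofNat n).val = n := by simp [ofNat, val]

theorem val_add (r s : RatCode) : (add r s).val = r.val + s.val := by
  have h : (((r.2.2 + 1) * (s.2.2 + 1) - 1 : ℕ) : ℚ) + 1 = (r.2.2 + 1) * (s.2.2 + 1) := by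
    have : 1 ≤ (r.2.2 + 1) * (s.2.2 + 1) := Nat.succ_le_of_lt (by positivity)
    push_cast [Nat.cast_sub this]; ring
  simp only [add, val, h]
  push_cast
  field_simp
  ring

theorem val_neg (r : RatCode) : (neg r).val = -r.val := by
  simp only [neg, val]; ring

theorem val_mul (r s : RatCode) : (mul r s).val = r.val * s.val := by
  have h : (((r.2.2 + 1) * (s.2.2 + 1) - 1 : ℕ) : ℚ) + 1 = (r.2.2 + 1) * (s.2.2 + 1) := by
    have : 1 ≤ (r.2.2 + 1) * (s.2.2 + 1) := Nat.succ_le_of_lt (by positivity)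
    push_cast [Nat.cast_sub this]; ring
  simp only [mul, val, h]
  push_cast
  field_simp
  ring

theorem val_inv (r : RatCode) : (inv r).val = r.val⁻¹ := by
  unfold inv
  split_ifs with h₁ h₂
  · have : ((r.1 - r.2.1 - 1 : ℕ) : ℚ) + 1 = r.1 - r.2.1 := by
      rw [Nat.cast_sub (by omega), Nat.cast_sub h₁.le]; push_cast; ring
    simp only [val, this, inv_div]; push_cast; ring
  · have : ((r.2.1 - r.1 - 1 : ℕ) : ℚ) + 1 = r.2.1 - r.1 := by
      rw [Nat.cast_sub (by omega), Nat.cast_sub h₂.le]; push_cast; ring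
    simp only [val, this, inv_div]
    rw [← neg_sub (r.2.1 : ℚ) r.1, div_neg]; push_cast; ring
  · have : r.1 = r.2.1 := by omega
    simp [val, this]

/-- Cross-multiplying and moving subtracted terms to the other side leaves only sums and products of
natural numbers, so the order is primitive recursive. -/
theorem val_le_iff (r s : RatCode) :
    r.val ≤ s.val ↔ r.1 * (s.2.2 + 1) + s.2.1 * (r.2.2 + 1) ≤
      s.1 * (r.2.2 + 1) + r.2.1 * (s.2.2 + 1) := by
  simp only [val]
  rw [div_le_div_iff₀ (by positivity) (by positivity), ← Nat.cast_le (α := ℚ)]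
  push_cast
  constructor <;> intro h <;> linarith

theorem exists_val_eq (q : ℚ) : ∃ r : RatCode, r.val = q := by
  refine ⟨(q.num.toNat, (-q.num).toNat, q.den - 1), ?_⟩
  have hd : ((q.den - 1 : ℕ) : ℚ) + 1 = q.den := by
    rw [Nat.cast_sub q.den_pos]; push_cast; ring
  have hn : ((q.num.toNat : ℕ) : ℚ) - ((-q.num).toNat : ℕ) = q.num := by
    have : ((q.num.toNat : ℕ) : ℤ) - ((-q.num).toNat : ℕ) = q.num := by omega
    exact_mod_cast this
  simp only [val, hd, hn, Rat.num_div_den]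

theorem primrec_add : Primrec₂ add := by
  unfold add
  have a : Primrec fun p : RatCode × RatCode => p.1.1 := Primrec.fst.comp Primrec.fst
  have b : Primrec fun p : RatCode × RatCode => p.1.2.1 :=
    Primrec.fst.comp (Primrec.snd.comp Primrec.fst)
  have c : Primrec fun p : RatCode × RatCode => p.1.2.2 + 1 :=
    Primrec.succ.comp (Primrec.snd.comp (Primrec.snd.comp Primrec.fst))
  have a' : Primrec fun p : RatCode × RatCode => p.2.1 := Primrec.fst.comp Primrec.snd
  have b' : Primrec fun p : RatCode × RatCode => p.2.2.1 :=
    Primrec.fst.comp (Primrec.snd.comp Primrec.snd)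
  have c' : Primrec fun p : RatCode × RatCode => p.2.2.2 + 1 :=
    Primrec.succ.comp (Primrec.snd.comp (Primrec.snd.comp Primrec.snd))
  have m := @Primrec.nat_mul
  have s := @Primrec.nat_add
  exact (s.comp (m.comp a c') (m.comp a' c)).pair
    ((s.comp (m.comp b c') (m.comp b' c)).pair (Primrec.pred.comp (m.comp c c')))

theorem primrec_mul : Primrec₂ mul := by
  unfold mul
  have a : Primrec fun p : RatCode × RatCode => p.1.1 := Primrec.fst.comp Primrec.fst
  have b : Primrec fun p : RatCode × RatCode => p.1.2.1 :=
    Primrec.fst.comp (Primrec.snd.comp Primrec.fst)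
  have c : Primrec fun p : RatCode × RatCode => p.1.2.2 + 1 :=
    Primrec.succ.comp (Primrec.snd.comp (Primrec.snd.comp Primrec.fst))
  have a' : Primrec fun p : RatCode × RatCode => p.2.1 := Primrec.fst.comp Primrec.snd
  have b' : Primrec fun p : RatCode × RatCode => p.2.2.1 :=
    Primrec.fst.comp (Primrec.snd.comp Primrec.snd)
  have c' : Primrec fun p : RatCode × RatCode => p.2.2.2 + 1 :=
    Primrec.succ.comp (Primrec.snd.comp (Primrec.snd.comp Primrec.snd))
  have m := @Primrec.nat_mul
  have s := @Primrec.nat_add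
  exact (s.comp (m.comp a a') (m.comp b b')).pair
    ((s.comp (m.comp a b') (m.comp b a')).pair (Primrec.pred.comp (m.comp c c')))

theorem primrec_neg : Primrec neg :=
  (Primrec.fst.comp Primrec.snd).pair (Primrec.fst.pair (Primrec.snd.comp Primrec.snd))

theorem primrec_inv : Primrec inv := by
  unfold inv
  have a : Primrec fun p : RatCode => p.1 := Primrec.fst
  have b : Primrec fun p : RatCode => p.2.1 := Primrec.fst.comp Primrec.snd
  have c : Primrec fun p : RatCode => p.2.2 + 1 :=
    Primrec.succ.comp (Primrec.snd.comp Primrec.snd)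
  have z : Primrec fun _ : RatCode => 0 := Primrec.const 0
  refine Primrec.ite (Primrec.nat_lt.comp b a)
    (c.pair (z.pair (Primrec.nat_sub.comp (Primrec.nat_sub.comp a b) (Primrec.const 1))))
    (Primrec.ite (Primrec.nat_lt.comp a b)
      (z.pair (c.pair (Primrec.nat_sub.comp (Primrec.nat_sub.comp b a) (Primrec.const 1))))
      (z.pair (z.pair z)))

theorem primrecRel_le : PrimrecRel fun r s : RatCode => r.val ≤ s.val := by
  have a : Primrec fun p : RatCode × RatCode => p.1.1 := Primrec.fst.comp Primrec.fst
  have b : Primrec fun p : RatCode × RatCode => p.1.2.1 :=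
    Primrec.fst.comp (Primrec.snd.comp Primrec.fst)
  have c : Primrec fun p : RatCode × RatCode => p.1.2.2 + 1 :=
    Primrec.succ.comp (Primrec.snd.comp (Primrec.snd.comp Primrec.fst))
  have a' : Primrec fun p : RatCode × RatCode => p.2.1 := Primrec.fst.comp Primrec.snd
  have b' : Primrec fun p : RatCode × RatCode => p.2.2.1 :=
    Primrec.fst.comp (Primrec.snd.comp Primrec.snd)
  have c' : Primrec fun p : RatCode × RatCode => p.2.2.2 + 1 :=
    Primrec.succ.comp (Primrec.snd.comp (Primrec.snd.comp Primrec.snd))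
  have m := @Primrec.nat_mul
  have s := @Primrec.nat_add
  exact PrimrecPred.of_eq (Primrec.nat_le.comp (s.comp (m.comp a c') (m.comp b' c))
    (s.comp (m.comp a' c) (m.comp b c'))) fun p => (val_le_iff p.1 p.2).symm

end RatCode

/-- `f` is computed by a primitive recursive function on codes of rational numbers. -/
def PrimrecRat {α : Type*} [Primcodable α] (f : α → ℚ) : Prop :=
  ∃ g : α → RatCode, Primrec g ∧ ∀ a, (g a).val = f a

/-! ### Closure properties of primitive recursive rational-valued functions -/

namespace PrimrecRat

variable {α β : Type*} [Primcodable α] [Primcodable β] {f g : α → ℚ}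

theorem of_eq (hf : PrimrecRat f) (h : ∀ a, f a = g a) : PrimrecRat g :=
  let ⟨F, hF, e⟩ := hf; ⟨F, hF, fun a => (e a).trans (h a)⟩

theorem val {r : α → RatCode} (hr : Primrec r) : PrimrecRat fun a => (r a).val :=
  ⟨r, hr, fun _ => rfl⟩

theorem const (q : ℚ) : PrimrecRat fun _ : α => q :=
  let ⟨r, hr⟩ := RatCode.exists_val_eq q; ⟨fun _ => r, Primrec.const r, fun _ => hr⟩

theorem natCast {n : α → ℕ} (hn : Primrec n) : PrimrecRat fun a => (n a : ℚ) :=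
  ⟨fun a => RatCode.ofNat (n a), hn.pair (Primrec.const (0, 0)), fun _ => RatCode.val_ofNat _⟩

theorem comp (hf : PrimrecRat f) {k : β → α} (hk : Primrec k) : PrimrecRat fun b => f (k b) :=
  let ⟨F, hF, e⟩ := hf; ⟨fun b => F (k b), hF.comp hk, fun b => e (k b)⟩

theorem add (hf : PrimrecRat f) (hg : PrimrecRat g) : PrimrecRat fun a => f a + g a :=
  let ⟨F, hF, e⟩ := hf
  let ⟨G, hG, e'⟩ := hg
  ⟨fun a => (F a).add (G a), RatCode.primrec_add.comp hF hG, fun a => by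
    rw [RatCode.val_add, e, e']⟩

theorem mul (hf : PrimrecRat f) (hg : PrimrecRat g) : PrimrecRat fun a => f a * g a :=
  let ⟨F, hF, e⟩ := hf
  let ⟨G, hG, e'⟩ := hg
  ⟨fun a => (F a).mul (G a), RatCode.primrec_mul.comp hF hG, fun a => by
    rw [RatCode.val_mul, e, e']⟩

theorem neg (hf : PrimrecRat f) : PrimrecRat fun a => -f a :=
  let ⟨F, hF, e⟩ := hf
  ⟨fun a => (F a).neg, RatCode.primrec_neg.comp hF, fun a => by rw [RatCode.val_neg, e]⟩

theorem inv (hf : PrimrecRat f) : PrimrecRat fun a => (f a)⁻¹ :=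
  let ⟨F, hF, e⟩ := hf
  ⟨fun a => (F a).inv, RatCode.primrec_inv.comp hF, fun a => by rw [RatCode.val_inv, e]⟩

theorem sub (hf : PrimrecRat f) (hg : PrimrecRat g) : PrimrecRat fun a => f a - g a :=
  (hf.add hg.neg).of_eq fun _ => (sub_eq_add_neg _ _).symm

theorem div (hf : PrimrecRat f) (hg : PrimrecRat g) : PrimrecRat fun a => f a / g a :=
  (hf.mul hg.inv).of_eq fun _ => (div_eq_mul_inv _ _).symm

theorem le (hf : PrimrecRat f) (hg : PrimrecRat g) : PrimrecPred fun a => f a ≤ g a :=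
  let ⟨_, hF, e⟩ := hf
  let ⟨_, hG, e'⟩ := hg
  (RatCode.primrecRel_le.comp hF hG).of_eq fun a => by rw [e, e']

theorem lt (hf : PrimrecRat f) (hg : PrimrecRat g) : PrimrecPred fun a => f a < g a :=
  (hg.le hf).not.of_eq fun _ => not_le

/-- A rational has many codes, so equality of values goes through the order and not through equality
of codes. -/
theorem eq (hf : PrimrecRat f) (hg : PrimrecRat g) : PrimrecPred fun a => f a = g a :=
  ((hf.le hg).and (hg.le hf)).of_eq fun _ => le_antisymm_iff.symm

theorem ite {p : α → Prop} [DecidablePred p] (hp : PrimrecPred p) (hf : PrimrecRat f)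
    (hg : PrimrecRat g) : PrimrecRat fun a => if p a then f a else g a :=
  let ⟨F, hF, e⟩ := hf
  let ⟨G, hG, e'⟩ := hg
  ⟨fun a => if p a then F a else G a, Primrec.ite hp hF hG, fun a => by
    by_cases h : p a <;> simp [h, e, e']⟩

theorem max (hf : PrimrecRat f) (hg : PrimrecRat g) : PrimrecRat fun a => max (f a) (g a) :=
  (ite (hf.le hg) hg hf).of_eq fun _ => (max_def _ _).symm

theorem min (hf : PrimrecRat f) (hg : PrimrecRat g) : PrimrecRat fun a => min (f a) (g a) :=
  (ite (hf.le hg) hf hg).of_eq fun _ => (min_def _ _).symm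

theorem abs (hf : PrimrecRat f) : PrimrecRat fun a => |f a| :=
  (hf.max hf.neg).of_eq fun _ => rfl

theorem pow (hf : PrimrecRat f) {n : α → ℕ} (hn : Primrec n) : PrimrecRat fun a => f a ^ n a :=
  let ⟨F, hF, e⟩ := hf
  ⟨fun a => Nat.rec (RatCode.ofNat 1) (fun _ r => r.mul (F a)) (n a),
    Primrec.nat_rec' hn (Primrec.const _)
      (RatCode.primrec_mul.comp₂ (Primrec.snd.comp₂ Primrec₂.right)
        (hF.comp₂ Primrec₂.left)), fun a => by
    beta_reduce
    generalize n a = m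
    induction m with
    | zero => simp [RatCode.val_ofNat]
    | succ k ih => simp only [RatCode.val_mul, ih, e, pow_succ]⟩

end PrimrecRat

/-! ### Recursion over consecutive vertices -/

/-- Right fold of `f` over the pairs of consecutive entries of a list. -/
def pairFold {V S : Type*} (f : V → V → S → S) (s : S) : List V → S
  | v :: w :: L => f v w (pairFold f s (w :: L))
  | _ => s

/-- List recursion passes the tail to each step, so the second entry of the current pair is the head
of the tail. -/
theorem primrec_pairFold {α V S : Type*} [Primcodable α] [Primcodable V] [Primcodable S]
    {f : α × V × V × S → S} {s : α → S} {L : α → List V} (hf : Primrec f) (hs : Primrec s)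
    (hL : Primrec L) :
    Primrec fun a => pairFold (fun v w t => f (a, v, w, t)) (s a) (L a) := by
  have step : Primrec₂ fun (a : α) (p : V × List V × S) =>
      Option.casesOn (motive := fun _ => S) p.2.1.head? (s a) fun w => f (a, p.1, w, p.2.2) := by
    refine Primrec.option_casesOn (o := fun q : α × V × List V × S => q.2.2.1.head?)
      (f := fun q => s q.1) (g := fun q w => f (q.1, q.2.1, w, q.2.2.2))
      (Primrec.list_head?.comp (Primrec.fst.comp (Primrec.snd.comp Primrec.snd)))
      (hs.comp Primrec.fst) ?_
    refine hf.comp ((Primrec.fst.comp Primrec.fst).pair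
      ((Primrec.fst.comp (Primrec.snd.comp Primrec.fst)).pair (Primrec.snd.pair
        (Primrec.snd.comp (Primrec.snd.comp (Primrec.snd.comp Primrec.fst))))))
  refine (Primrec.list_rec hL hs step).of_eq fun a => ?_
  induction L a with
  | nil => rfl
  | cons v l ih =>
    cases l with
    | nil => rfl
    | cons w l =>
      simp only [pairFold]
      rw [← ih]
      rfl

theorem PrimrecRat.pairFold {α V : Type*} [Primcodable α] [Primcodable V]
    {f : α × V × V → ℚ → ℚ} {L : α → List V}
    (hf : PrimrecRat fun p : α × V × V × RatCode => f (p.1, p.2.1, p.2.2.1) p.2.2.2.val)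
    (hL : Primrec L) :
    PrimrecRat fun a => MarkovAnalysis.pairFold (fun v w t => f (a, v, w) t) 0 (L a) := by
  obtain ⟨F, hF, e⟩ := hf
  refine ⟨_, primrec_pairFold hF (Primrec.const (RatCode.ofNat 0)) hL, fun a => ?_⟩
  beta_reduce
  generalize L a = l
  induction l with
  | nil => simp [MarkovAnalysis.pairFold, RatCode.val_ofNat]
  | cons v l ih =>
    cases l with
    | nil => simp [MarkovAnalysis.pairFold, RatCode.val_ofNat]
    | cons w l => simp only [MarkovAnalysis.pairFold, e, ih]

/-! ### Polygonal functions -/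

namespace PolyCode

/-- The value of a polygonal function at a rational point. -/
def evalRat (L : PolyCode) (x : ℚ) : ℚ :=
  pairFold (fun v w t => if x ≤ w.1.val then
    (w.2.val * (x - v.1.val) + v.2.val * (w.1.val - x)) / (w.1.val - v.1.val) else t) 0 L

/-- The sum of the absolute values of the slopes, a Lipschitz constant. -/
def lip (L : PolyCode) : ℚ :=
  pairFold (fun v w t => |(w.2.val - v.2.val) / (w.1.val - v.1.val)| + t) 0 L

theorem eval_cons_cons (v w : RatCode × RatCode) (L : PolyCode) (x : ℝ) :
    eval (v :: w :: L) x = if x ≤ (w.1.val : ℝ) then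
        ((w.2.val : ℝ) * (x - (v.1.val : ℝ)) + (v.2.val : ℝ) * ((w.1.val : ℝ) - x)) /
          ((w.1.val : ℝ) - (v.1.val : ℝ))
      else eval (w :: L) x := by
  rw [eval]

theorem cast_evalRat (L : PolyCode) (x : ℚ) : ((evalRat L x : ℚ) : ℝ) = L.eval x := by
  unfold evalRat
  induction L with
  | nil => simp [pairFold, eval]
  | cons v L ih =>
    cases L with
    | nil => simp [pairFold, eval]
    | cons w L =>
      rw [eval_cons_cons, ← ih, pairFold]
      simp only [Rat.cast_le]
      split_ifs <;> push_cast <;> rfl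

theorem integral_eq_pairFold (L : PolyCode) : L.integral =
    pairFold (fun v w t => (w.2.val + v.2.val) * (w.1.val - v.1.val) / 2 + t) 0 L := by
  induction L with
  | nil => simp [pairFold, integral]
  | cons v L ih =>
    cases L with
    | nil => simp [pairFold, integral]
    | cons w L => rw [integral, ih, pairFold]

theorem primrecRat_evalRat :
    PrimrecRat fun p : PolyCode × RatCode => p.1.evalRat p.2.val := by
  have pv : Primrec fun q : (PolyCode × RatCode) × (RatCode × RatCode) × (RatCode × RatCode) ×
    RatCode => q.2.1 := Primrec.fst.comp Primrec.snd
  have pw : Primrec fun q : (PolyCode × RatCode) × (RatCode × RatCode) × (RatCode × RatCode) ×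
    RatCode => q.2.2.1 := Primrec.fst.comp (Primrec.snd.comp Primrec.snd)
  have x : PrimrecRat fun q : (PolyCode × RatCode) × (RatCode × RatCode) × (RatCode × RatCode) ×
    RatCode => q.1.2.val := .val (Primrec.snd.comp Primrec.fst)
  have t : PrimrecRat fun q : (PolyCode × RatCode) × (RatCode × RatCode) × (RatCode × RatCode) ×
    RatCode => q.2.2.2.val := .val (Primrec.snd.comp (Primrec.snd.comp Primrec.snd))
  have v1 := PrimrecRat.val (Primrec.fst.comp pv)
  have v2 := PrimrecRat.val (Primrec.snd.comp pv)
  have w1 := PrimrecRat.val (Primrec.fst.comp pw)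
  have w2 := PrimrecRat.val (Primrec.snd.comp pw)
  exact PrimrecRat.pairFold (α := PolyCode × RatCode) (V := RatCode × RatCode) (L := Prod.fst)
    (f := fun q t => if q.1.2.val ≤ q.2.2.1.val then
      (q.2.2.2.val * (q.1.2.val - q.2.1.1.val) + q.2.1.2.val * (q.2.2.1.val - q.1.2.val)) /
        (q.2.2.1.val - q.2.1.1.val) else t)
    (.ite (x.le w1) (((w2.mul (x.sub v1)).add (v2.mul (w1.sub x))).div (w1.sub v1)) t)
    Primrec.fst

theorem primrecRat_lip : PrimrecRat lip := by
  have pv : Primrec fun q : PolyCode × (RatCode × RatCode) × (RatCode × RatCode) ×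
    RatCode => q.2.1 := Primrec.fst.comp Primrec.snd
  have pw : Primrec fun q : PolyCode × (RatCode × RatCode) × (RatCode × RatCode) ×
    RatCode => q.2.2.1 := Primrec.fst.comp (Primrec.snd.comp Primrec.snd)
  have t : PrimrecRat fun q : PolyCode × (RatCode × RatCode) × (RatCode × RatCode) ×
    RatCode => q.2.2.2.val := .val (Primrec.snd.comp (Primrec.snd.comp Primrec.snd))
  have v1 := PrimrecRat.val (Primrec.fst.comp pv)
  have v2 := PrimrecRat.val (Primrec.snd.comp pv)
  have w1 := PrimrecRat.val (Primrec.fst.comp pw)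
  have w2 := PrimrecRat.val (Primrec.snd.comp pw)
  exact PrimrecRat.pairFold (α := PolyCode) (V := RatCode × RatCode) (L := id)
    (f := fun q t => |(q.2.2.2.val - q.2.1.2.val) / (q.2.2.1.val - q.2.1.1.val)| + t)
    (((w2.sub v2).div (w1.sub v1)).abs.add t) Primrec.id

theorem primrecRat_integral : PrimrecRat integral := by
  have pv : Primrec fun q : PolyCode × (RatCode × RatCode) × (RatCode × RatCode) ×
    RatCode => q.2.1 := Primrec.fst.comp Primrec.snd
  have pw : Primrec fun q : PolyCode × (RatCode × RatCode) × (RatCode × RatCode) ×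
    RatCode => q.2.2.1 := Primrec.fst.comp (Primrec.snd.comp Primrec.snd)
  have t : PrimrecRat fun q : PolyCode × (RatCode × RatCode) × (RatCode × RatCode) ×
    RatCode => q.2.2.2.val := .val (Primrec.snd.comp (Primrec.snd.comp Primrec.snd))
  have v1 := PrimrecRat.val (Primrec.fst.comp pv)
  have v2 := PrimrecRat.val (Primrec.snd.comp pv)
  have w1 := PrimrecRat.val (Primrec.fst.comp pw)
  have w2 := PrimrecRat.val (Primrec.snd.comp pw)
  exact (PrimrecRat.pairFold (α := PolyCode) (V := RatCode × RatCode) (L := id)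
    (f := fun q t => (q.2.2.2.val + q.2.1.2.val) * (q.2.2.1.val - q.2.1.1.val) / 2 + t)
    ((((w2.add v2).mul (w1.sub v1)).div (.const 2)).add t) Primrec.id).of_eq fun L =>
      (integral_eq_pairFold L).symm

/-- The abscissae of the vertices are increasing. -/
def Increasing (L : PolyCode) : Prop := (L.map fun v => v.1.val).Pairwise (· < ·)

theorem Increasing.tail {v : RatCode × RatCode} {L : PolyCode} (h : Increasing (v :: L)) :
    Increasing L := (List.pairwise_cons.1 h).2

theorem Increasing.lt {v w : RatCode × RatCode} {L : PolyCode} (h : Increasing (v :: L))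
    (hw : w ∈ L) : v.1.val < w.1.val :=
  (List.pairwise_cons.1 h).1 _ (List.mem_map_of_mem hw)

theorem Increasing.lt_real {v w : RatCode × RatCode} {L : PolyCode}
    (h : Increasing (v :: w :: L)) : (v.1.val : ℝ) < w.1.val :=
  Rat.cast_lt.2 (h.lt (List.mem_cons_self))

/-- By transitivity it suffices to compare neighbours, which `primrec_pairFold` can do. -/
theorem increasing_iff_pairFold (L : PolyCode) : Increasing L ↔
    pairFold (fun v w t => decide (v.1.val < w.1.val) && t) true L = true := by
  induction L with
  | nil => simp [pairFold, Increasing]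
  | cons v L ih =>
    cases L with
    | nil => simp [pairFold, Increasing]
    | cons w L =>
      rw [pairFold, Bool.and_eq_true, ← ih, decide_eq_true_iff]
      refine ⟨fun h => ⟨h.lt List.mem_cons_self, h.tail⟩, fun h => ?_⟩
      refine List.pairwise_cons.2 ⟨fun q hq => ?_, h.2⟩
      rcases List.mem_cons.1 hq with rfl | hq
      · exact h.1
      · obtain ⟨u, hu, rfl⟩ := List.mem_map.1 hq
        exact h.1.trans (h.2.lt hu)

/-- The length bound excludes one-vertex lists, on which `eval` takes its default value 0. -/
theorem eval_vertex {L : PolyCode} (hL : Increasing L) (h2 : 2 ≤ L.length)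
    {u : RatCode × RatCode} (hu : u ∈ L) : L.eval u.1.val = u.2.val := by
  induction L with
  | nil => simp at hu
  | cons v L ih =>
    cases L with
    | nil => simp at h2
    | cons w L =>
      have hvw := hL.lt_real
      have hne : (w.1.val : ℝ) - v.1.val ≠ 0 := by linarith
      rw [eval_cons_cons]
      rcases List.mem_cons.1 hu with rfl | hu
      · rw [if_pos hvw.le]; field_simp; ring
      · by_cases huw : u = w
        · subst huw
          rw [if_pos le_rfl]; field_simp; ring
        · have hu' : u ∈ L := (List.mem_cons.1 hu).resolve_left huw
          rw [if_neg (by exact_mod_cast (hL.tail.lt hu').not_ge)]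
          refine ih hL.tail ?_ hu
          cases L <;> simp_all

theorem lip_nonneg (L : PolyCode) : 0 ≤ lip L := by
  unfold lip
  induction L with
  | nil => simp [pairFold]
  | cons v L ih =>
    cases L with
    | nil => simp [pairFold]
    | cons w L => rw [pairFold]; positivity

/-- Each segment contributes at most its own slope; if a vertex separates x from y, the difference
is split there. To the right of the last vertex `eval` drops to 0, hence the bound by b. No bound
from below is needed, since the formula of the first segment extends to the left. -/
theorem abs_eval_sub_le {L : PolyCode} (hL : Increasing L) {b : ℚ}
    (hb : (L.map fun v => v.1.val).getLast? = some b) {x y : ℝ} (hxy : x ≤ y) (hy : y ≤ b) :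
    |L.eval y - L.eval x| ≤ L.lip * (y - x) := by
  induction L generalizing x with
  | nil => simp at hb
  | cons v L ih =>
    cases L with
    | nil => simp [eval, lip, pairFold]
    | cons w L =>
      have hvw := hL.lt_real
      have hne : (w.1.val : ℝ) - v.1.val ≠ 0 := by linarith
      have hb' : ((w :: L).map fun v => v.1.val).getLast? = some b := by
        simpa [List.getLast?_cons_cons] using hb
      have hlip : ((lip (v :: w :: L) : ℚ) : ℝ) =
          |((w.2.val : ℝ) - v.2.val) / (w.1.val - v.1.val)| + lip (w :: L) := by
        simp only [lip, pairFold]; push_cast; rfl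
      have hpos : (0 : ℝ) ≤ lip (w :: L) := by exact_mod_cast lip_nonneg _
      have affine : ∀ s t : ℝ,
          ((w.2.val : ℝ) * (t - v.1.val) + v.2.val * (w.1.val - t)) / (w.1.val - v.1.val) -
          ((w.2.val : ℝ) * (s - v.1.val) + v.2.val * (w.1.val - s)) / (w.1.val - v.1.val) =
          (((w.2.val : ℝ) - v.2.val) / (w.1.val - v.1.val)) * (t - s) := fun s t => by
        field_simp; ring
      set σ := ((w.2.val : ℝ) - v.2.val) / (w.1.val - v.1.val) with hσ
      rw [eval_cons_cons, eval_cons_cons, hlip]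
      by_cases hyw : y ≤ w.1.val
      · rw [if_pos hyw, if_pos (hxy.trans hyw), affine, abs_mul, abs_of_nonneg (sub_nonneg.2 hxy)]
        nlinarith [mul_nonneg hpos (sub_nonneg.2 hxy)]
      · rw [if_neg hyw]
        push Not at hyw
        by_cases hxw : x ≤ w.1.val
        · rw [if_pos hxw]
          have h2 : 2 ≤ (w :: L).length := by
            cases L with
            | nil =>
              simp at hb'
              subst hb'
              exact absurd hyw hy.not_gt
            | cons _ _ => simp
          have h1 := ih hL.tail hb' hyw.le
          have h3 := eval_vertex hL.tail h2 List.mem_cons_self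
          have h4 := affine x w.1.val
          have h5 : ((w.2.val : ℝ) * (w.1.val - v.1.val) + v.2.val * (w.1.val - w.1.val)) /
            (w.1.val - v.1.val) = w.2.val := by field_simp; ring
          rw [h5] at h4
          rw [h3] at h1
          have h6 : |σ * (w.1.val - x)| = |σ| * (w.1.val - x) := by
            rw [abs_mul, abs_of_nonneg (sub_nonneg.2 hxw)]
          rw [← h4] at h6
          have h7 := abs_sub_le (eval (w :: L) y) w.2.val
            (((w.2.val : ℝ) * (x - v.1.val) + v.2.val * (w.1.val - x)) / (w.1.val - v.1.val))
          nlinarith [mul_nonneg hpos (sub_nonneg.2 hxw),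
            mul_nonneg (abs_nonneg σ) (sub_nonneg.2 hyw.le)]
        · rw [if_neg hxw]
          have := ih hL.tail hb' hxy
          nlinarith [mul_nonneg (abs_nonneg σ) (sub_nonneg.2 hxy)]

theorem eval_nonneg_of_vertices {L : PolyCode} (hL : Increasing L)
    (h0 : ∀ v ∈ L, 0 ≤ v.2.val) {x : ℝ} (hx : ∀ v ∈ L.head?, (v.1.val : ℝ) ≤ x) :
    0 ≤ L.eval x := by
  induction L with
  | nil => simp [eval]
  | cons v L ih =>
    cases L with
    | nil => simp [eval]
    | cons w L =>
      have hvw := hL.lt_real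
      have hv : (0 : ℝ) ≤ v.2.val := by exact_mod_cast h0 v List.mem_cons_self
      have hw : (0 : ℝ) ≤ w.2.val := by
        exact_mod_cast h0 w (List.mem_cons_of_mem _ List.mem_cons_self)
      have hx' : (v.1.val : ℝ) ≤ x := hx v rfl
      rw [eval_cons_cons]
      split_ifs with h
      · exact div_nonneg (add_nonneg (mul_nonneg hw (by linarith)) (mul_nonneg hv (by linarith)))
          (by linarith)
      · refine ih hL.tail (fun u hu => h0 u (List.mem_cons_of_mem _ hu)) fun u hu => ?_
        obtain rfl : w = u := by simpa using hu
        exact (not_le.1 h).le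

/-- The first segment is an affine integral and the rest is the induction hypothesis. On intervals
open at the left, the two branches of `eval` are exactly the two pieces, so the value at the common
vertex causes no trouble. -/
theorem integral_eq_intervalIntegral_aux {L : PolyCode} (hL : Increasing L) {a b : ℚ}
    (ha : (L.map fun v => v.1.val).head? = some a)
    (hb : (L.map fun v => v.1.val).getLast? = some b) :
    (a : ℝ) ≤ b ∧ IntervalIntegrable L.eval MeasureTheory.volume a b ∧
      ∫ x in (a : ℝ)..b, L.eval x = L.integral := by
  induction L generalizing a with
  | nil => simp at hb
  | cons v L ih =>
    cases L with
    | nil =>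
      simp at ha hb
      subst ha hb
      simp [integral]
    | cons w L =>
      have hvw := hL.lt_real
      have hne : (w.1.val : ℝ) - v.1.val ≠ 0 := by linarith
      obtain rfl : v.1.val = a := by simpa using ha
      have hb' : ((w :: L).map fun v => v.1.val).getLast? = some b := by
        simpa [List.getLast?_cons_cons] using hb
      obtain ⟨hwb, hi, he⟩ := ih hL.tail (a := w.1.val) (by simp) hb'
      have e1 : EqOn (eval (v :: w :: L)) (fun x => ((w.2.val : ℝ) * (x - v.1.val) +
          v.2.val * (w.1.val - x)) / (w.1.val - v.1.val)) (uIoc (v.1.val : ℝ) w.1.val) := by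
        intro x hx
        rw [uIoc_of_le hvw.le] at hx
        rw [eval_cons_cons, if_pos hx.2]
      have e2 : EqOn (eval (v :: w :: L)) (eval (w :: L)) (uIoc (w.1.val : ℝ) b) := by
        intro x hx
        rw [uIoc_of_le hwb] at hx
        rw [eval_cons_cons, if_neg hx.1.not_ge]
      have i1 : IntervalIntegrable (eval (v :: w :: L)) MeasureTheory.volume
          (v.1.val : ℝ) w.1.val :=
        IntervalIntegrable.congr e1.symm (Continuous.intervalIntegrable (by fun_prop) _ _)
      have i2 : IntervalIntegrable (eval (v :: w :: L)) MeasureTheory.volume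
          (w.1.val : ℝ) b := IntervalIntegrable.congr e2.symm hi
      refine ⟨hvw.le.trans hwb, i1.trans i2, ?_⟩
      rw [← intervalIntegral.integral_add_adjacent_intervals i1 i2,
        intervalIntegral.integral_congr_ae (Eventually.of_forall e2), he,
        intervalIntegral.integral_congr_ae (Eventually.of_forall e1), integral]
      push_cast
      congr 1
      have e3 : (fun x : ℝ => ((w.2.val : ℝ) * (x - v.1.val) + v.2.val * (w.1.val - x)) /
          (w.1.val - v.1.val)) = fun x => ((w.2.val : ℝ) - v.2.val) / (w.1.val - v.1.val) * x +
          ((v.2.val : ℝ) * w.1.val - w.2.val * v.1.val) / (w.1.val - v.1.val) := by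
        funext x; field_simp; ring
      rw [e3, intervalIntegral.integral_add (Continuous.intervalIntegrable (by fun_prop) _ _)
        (Continuous.intervalIntegrable (by fun_prop) _ _), intervalIntegral.integral_const_mul,
        integral_id, intervalIntegral.integral_const, smul_eq_mul]
      field_simp
      ring

variable {L : PolyCode}

theorem IsPolygonal.increasing (h : L.IsPolygonal) : Increasing L := h.2.2

theorem IsPolygonal.two_le_length (h : L.IsPolygonal) : 2 ≤ L.length := by
  obtain ⟨h0, h1, -⟩ := h
  match L with
  | [] => simp at h0
  | [v] => simp at h0 h1; rw [h0] at h1; norm_num at h1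
  | _ :: _ :: _ => simp

theorem IsPolygonal.mem_Icc (h : L.IsPolygonal) {v : RatCode × RatCode} (hv : v ∈ L) :
    v.1.val ∈ Icc (0 : ℚ) 1 := by
  obtain ⟨h0, h1, h2⟩ := h
  have hm : v.1.val ∈ L.map fun v => v.1.val := List.mem_map_of_mem hv
  generalize (L.map fun v => v.1.val) = l at *
  refine ⟨?_, ?_⟩
  · obtain ⟨l', rfl⟩ : ∃ l', l = 0 :: l' := by
      cases l <;> simp_all
    rcases List.mem_cons.1 hm with h | h
    · exact h.ge
    · exact ((List.pairwise_cons.1 h2).1 _ h).le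
  · obtain ⟨l', rfl⟩ : ∃ l', l = l' ++ [1] := by
      exact List.getLast?_eq_some_iff.1 h1
    rcases List.mem_append.1 hm with h | h
    · exact ((List.pairwise_append.1 h2).2.2 _ h _ (by simp)).le
    · exact (by simpa using h : v.1.val = 1).le

theorem IsPolygonal.abs_sub_le (h : L.IsPolygonal) {x y : ℝ} (hx : x ≤ 1)
    (hy : y ≤ 1) : |L.eval x - L.eval y| ≤ L.lip * |x - y| := by
  rcases le_total x y with hxy | hxy
  · rw [abs_sub_comm, abs_sub_comm x, abs_of_nonneg (sub_nonneg.2 hxy)]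
    exact abs_eval_sub_le h.increasing h.2.1 hxy (by simpa using hy)
  · rw [abs_of_nonneg (sub_nonneg.2 hxy)]
    exact abs_eval_sub_le h.increasing h.2.1 hxy (by simpa using hx)

theorem IsPolygonal.intervalIntegrable (h : L.IsPolygonal) :
    IntervalIntegrable L.eval MeasureTheory.volume 0 1 := by
  simpa using (integral_eq_intervalIntegral_aux h.2.2 h.1 h.2.1).2.1

theorem IsPolygonal.integral_eq (h : L.IsPolygonal) :
    (L.integral : ℝ) = ∫ x in (0 : ℝ)..1, L.eval x := by
  simpa using (integral_eq_intervalIntegral_aux h.2.2 h.1 h.2.1).2.2.symm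

theorem primrecPred_isPolygonal : PrimrecPred IsPolygonal := by
  have h0 : PrimrecPred fun L : PolyCode =>
      L.head?.map (fun v => decide (v.1.val = 0)) = some true := by
    refine Primrec.eq.comp (Primrec.option_map Primrec.list_head? ?_) (Primrec.const _)
    exact ((PrimrecRat.val (Primrec.fst.comp Primrec.snd)).eq (.const 0)).decide
  have h1 : PrimrecPred fun L : PolyCode =>
      L.reverse.head?.map (fun v => decide (v.1.val = 1)) = some true := by
    refine Primrec.eq.comp (Primrec.option_map
      (Primrec.list_head?.comp Primrec.list_reverse) ?_) (Primrec.const _)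
    exact ((PrimrecRat.val (Primrec.fst.comp Primrec.snd)).eq (.const 1)).decide
  have h2 : PrimrecPred Increasing := by
    refine PrimrecPred.of_eq (Primrec.eq.comp (primrec_pairFold (α := PolyCode)
      (V := RatCode × RatCode) (L := id) (s := fun _ => true)
      (f := fun q => decide (q.2.1.1.val < q.2.2.1.1.val) && q.2.2.2)
      (Primrec.and.comp ?_ ?_) (Primrec.const _) Primrec.id) (Primrec.const true))
      fun L => (increasing_iff_pairFold L).symm
    · exact ((PrimrecRat.val (Primrec.fst.comp (Primrec.fst.comp Primrec.snd))).lt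
        (.val (Primrec.fst.comp (Primrec.fst.comp (Primrec.snd.comp Primrec.snd))))).decide
    · exact Primrec.snd.comp (Primrec.snd.comp Primrec.snd)
  refine (h0.and (h1.and h2)).of_eq fun L => ?_
  unfold IsPolygonal Increasing
  refine and_congr ?_ (and_congr ?_ Iff.rfl)
  · cases L <;> simp
  · rw [List.getLast?_eq_head?_reverse, ← List.map_reverse]
    cases L.reverse <;> simp

end PolyCode

/-! ### Rational points -/

/-- The code of a rational number as a constructive real number. -/
def RealCode.ofRatCode (r : RatCode) : RealCode :=
  (Nat.Partrec.Code.const (Encodable.encode r), Nat.Partrec.Code.const 0)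

theorem RealCode.represents_ofRatCode (r : RatCode) :
    (RealCode.ofRatCode r).Represents (r.val : ℝ) := by
  refine ⟨fun _ => r, fun _ => 0, fun n => ?_, fun n => ?_, fun n i j _ _ => ?_,
    tendsto_const_nhds⟩
  · simp [RealCode.ofRatCode, Nat.Partrec.Code.eval_const]
  · simp [RealCode.ofRatCode, Nat.Partrec.Code.eval_const]
  · rw [sub_self, abs_zero]; positivity

theorem RealCode.primrec_ofRatCode : Primrec RealCode.ofRatCode :=
  (Nat.Partrec.Code.primrec_const.comp Primrec.encode).pair (Primrec.const _)

/-- A rational number in `[0, 1]` as a constructive point. -/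
def UnitPoint.ofRat (q : ℚ) (hq : q ∈ Icc (0 : ℚ) 1) : UnitPoint :=
  ⟨q, ⟨by exact_mod_cast hq.1, by exact_mod_cast hq.2⟩, by
    obtain ⟨r, rfl⟩ := RatCode.exists_val_eq q
    exact ⟨_, RealCode.represents_ofRatCode r⟩⟩

@[simp] theorem UnitPoint.val_ofRat (q : ℚ) (hq : q ∈ Icc (0 : ℚ) 1) :
    (UnitPoint.ofRat q hq).1 = q := rfl

namespace PolyCode

/-- Vertices are rational, hence constructive points, and interpolation preserves nonnegativity.
This replaces a quantifier over points by a finite check, which makes admissibility decidable. -/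
theorem IsPolygonal.nonneg_iff {L : PolyCode} (h : L.IsPolygonal) :
    (∀ x : UnitPoint, 0 ≤ L.eval x.1) ↔ ∀ v ∈ L, 0 ≤ v.2.val := by
  refine ⟨fun h0 v hv => ?_, fun h0 x => ?_⟩
  · have := h0 (.ofRat _ (h.mem_Icc hv))
    rw [UnitPoint.val_ofRat, eval_vertex h.increasing h.two_le_length hv] at this
    exact_mod_cast this
  · refine eval_nonneg_of_vertices h.increasing h0 fun v hv => ?_
    have h1 := h.1
    cases L with
    | nil => simp at hv
    | cons w L =>
      obtain rfl : w = v := by simpa using hv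
      have h1 : w.1.val = 0 := by simpa using h1
      rw [h1]; simpa using x.2.1.1

end PolyCode

theorem Output.primrecPred_admissible : PrimrecPred Output.Admissible := by
  have h1 : PrimrecPred fun o : Output => 0 < o.1.val :=
    (PrimrecRat.const 0).lt (.val Primrec.fst)
  have h2 : PrimrecPred fun o : Output => o.2.IsPolygonal :=
    PolyCode.primrecPred_isPolygonal.comp Primrec.snd
  have h3 : PrimrecPred fun o : Output => ∀ v ∈ o.2, 0 ≤ v.2.val :=
    (PrimrecPred.forall_mem_list (α := RatCode × RatCode) (p := fun v => 0 ≤ v.2.val)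
      ((PrimrecRat.const 0).le (.val Primrec.snd))).comp Primrec.snd
  have h4 : PrimrecPred fun o : Output => o.2.integral < 1 / 2 :=
    (PolyCode.primrecRat_integral.comp Primrec.snd).lt (.const _)
  refine (h1.and (h2.and (h3.and h4))).of_eq fun o => ?_
  unfold Output.Admissible
  refine and_congr Iff.rfl (and_congr_right fun h => and_congr h.nonneg_iff.symm Iff.rfl)

/-! ### Polygonal functions on uniform grids -/

/-- The polygonal function with the value `v k` at the point `k / (n + 1)`, `0 ≤ k ≤ n + 1`. -/
def PolyCode.grid (n : ℕ) (v : ℕ → RatCode) : PolyCode :=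
  (List.range (n + 2)).map fun k => ((k, 0, n), v k)

namespace PolyCode

theorem val_grid_point (k n : ℕ) : RatCode.val (k, 0, n) = (k : ℚ) / (n + 1) := by
  simp [RatCode.val]

theorem isPolygonal_grid (n : ℕ) (v : ℕ → RatCode) : (grid n v).IsPolygonal := by
  have e : ((grid n v).map fun v => v.1.val) =
      (List.range (n + 2)).map fun k : ℕ => (k : ℚ) / (n + 1) := by
    simp [grid, val_grid_point]
  unfold IsPolygonal
  rw [e]
  refine ⟨?_, ?_, ?_⟩
  · simp [List.range_succ_eq_map]
  · rw [List.range_succ]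
    simp
    exact Nat.cast_add_one_ne_zero (R := ℚ) n
  · rw [List.pairwise_map]
    refine List.pairwise_lt_range.imp fun {a b} h => ?_
    have : (a : ℚ) < b := by exact_mod_cast h
    gcongr

theorem eval_grid_aux (n m s k : ℕ) (v : ℕ → RatCode) (hsk : s ≤ k) (hk : k ≤ s + m) {x : ℝ}
    (h1 : (k : ℝ) ≤ (n + 1) * x) (h2 : (n + 1) * x ≤ k + 1) :
    eval ((List.range' s (m + 2)).map fun k => ((k, 0, n), v k)) x =
      (v (k + 1)).val * ((n + 1) * x - k) + (v k).val * (k + 1 - (n + 1) * x) := by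
  have hn : (0 : ℝ) < n + 1 := by positivity
  have direct : ∀ j : ℕ,
      (((v (j + 1)).val : ℝ) * (x - ((RatCode.val (j, 0, n) : ℚ) : ℝ)) +
        (v j).val * (((RatCode.val (j + 1, 0, n) : ℚ) : ℝ) - x)) /
        (((RatCode.val (j + 1, 0, n) : ℚ) : ℝ) - ((RatCode.val (j, 0, n) : ℚ) : ℝ)) =
      (v (j + 1)).val * ((n + 1) * x - j) + (v j).val * (j + 1 - (n + 1) * x) := fun j => by
    simp only [val_grid_point]
    push_cast
    have : ((j : ℝ) + 1) / (n + 1) - j / (n + 1) = 1 / (n + 1) := by field_simp; ring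
    rw [this]
    field_simp
  have hle : ∀ j : ℕ, x ≤ ((RatCode.val (j + 1, 0, n) : ℚ) : ℝ) ↔ (n + 1) * x ≤ j + 1 :=
    fun j => by
      rw [val_grid_point]
      push_cast
      rw [le_div_iff₀ hn, mul_comm]
  induction m generalizing s with
  | zero =>
    obtain rfl : s = k := by omega
    simp only [List.range'_succ, List.map_cons, eval_cons_cons]
    rw [if_pos ((hle s).2 h2), direct]
  | succ m ih =>
    rw [List.range'_succ, List.range'_succ, List.map_cons, List.map_cons, eval_cons_cons]
    rcases hsk.eq_or_lt with rfl | hsk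
    · rw [if_pos ((hle s).2 h2), direct]
    · split_ifs with h
      -- At a shared vertex `eval` uses the segment on the left; so x is the left end of cell k = s
      -- + 1, where both formulas give the value of `v k`.
      · rw [hle] at h
        have : (s : ℝ) + 1 ≤ k := by exact_mod_cast hsk
        obtain rfl : k = s + 1 := by
          have : (k : ℝ) ≤ (s + 1 : ℕ) := by push_cast; linarith
          have := Nat.cast_le.1 this
          omega
        rw [direct]
        push_cast at h1 ⊢
        have : ((n : ℝ) + 1) * x = s + 1 := le_antisymm h h1
        rw [this]; ring
      · exact ih (s + 1) hsk (by omega)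

theorem eval_grid {n k : ℕ} (v : ℕ → RatCode) (hk : k ≤ n) {x : ℝ}
    (h1 : (k : ℝ) ≤ (n + 1) * x) (h2 : (n + 1) * x ≤ k + 1) :
    eval (grid n v) x =
      (v (k + 1)).val * ((n + 1) * x - k) + (v k).val * (k + 1 - (n + 1) * x) := by
  rw [grid, List.range_eq_range']
  exact eval_grid_aux n n 0 k v (Nat.zero_le _) (by omega) h1 h2

theorem exists_cell (n : ℕ) {x : ℝ} (hx : x ∈ Icc (0 : ℝ) 1) :
    ∃ k ≤ n, (k : ℝ) ≤ (n + 1) * x ∧ (n + 1) * x ≤ k + 1 := by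
  have h0 : 0 ≤ (n + 1) * x := mul_nonneg (by positivity) hx.1
  rcases le_or_gt ⌊(n + 1) * x⌋₊ n with h | h
  · exact ⟨_, h, Nat.floor_le h0, (Nat.lt_floor_add_one _).le⟩
  -- Only x = 1 reaches this case; it is assigned to the last cell.
  · refine ⟨n, le_rfl, ?_, ?_⟩
    · have : ((n + 1 : ℕ) : ℝ) ≤ (n + 1) * x := (Nat.le_floor_iff h0).1 h
      push_cast at this; linarith
    · nlinarith [hx.2]

theorem primrec_grid {α : Type*} [Primcodable α] {n : α → ℕ} {v : α → ℕ → RatCode}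
    (hn : Primrec n) (hv : Primrec₂ v) : Primrec fun a => grid (n a) (v a) := by
  refine Primrec.list_map (Primrec.list_range.comp (Primrec.nat_add.comp hn (Primrec.const 2))) ?_
  exact (Primrec.snd.pair ((Primrec.const 0).pair (hn.comp Primrec.fst))).pair hv

end PolyCode

/-! ### Effective search and enumeration -/

theorem _root_.PrimrecPred.comp_computable {α β : Type*} [Primcodable α] [Primcodable β]
    {p : β → Prop} (hp : PrimrecPred p) {f : α → β} (hf : Computable f) :
    ComputablePred fun a => p (f a) :=
  let ⟨_, h⟩ := hp; ⟨fun _ => inferInstance, h.to_comp.comp hf⟩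

/-- Unbounded search through the encoded candidates. -/
theorem _root_.ComputablePred.exists_partrec_choice {α β : Type*} [Primcodable α] [Primcodable β]
    {P : α × β → Prop} (hP : ComputablePred P) :
    ∃ f : α →. β, Partrec f ∧ (∀ a, ∀ b ∈ f a, P (a, b)) ∧ ∀ a b, P (a, b) → (f a).Dom := by
  obtain ⟨_, hP⟩ := hP
  refine ⟨fun a => Nat.rfindOpt fun n => (Encodable.decode n : Option β).bind fun b =>
    bif decide (P (a, b)) then some b else none, ?_, ?_, ?_⟩
  · refine Partrec.rfindOpt ?_
    refine Computable.option_bind (Computable.decode.comp Computable.snd) ?_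
    exact Computable.cond (hP.comp ((Computable.fst.comp Computable.fst).pair Computable.snd))
      (Computable.option_some.comp Computable.snd) (Computable.const _)
  · intro a b hb
    obtain ⟨n, hn⟩ := Nat.rfindOpt_spec hb
    obtain ⟨b', -, h⟩ := Option.bind_eq_some_iff.1 hn
    by_cases hp : P (a, b')
    · simp [hp] at h; exact h ▸ hp
    · simp [hp] at h
  · intro a b hb
    exact Nat.rfindOpt_dom.2 ⟨Encodable.encode b, b, by simp [hb]⟩

/-- A recursively enumerable relation is the projection of a decidable increasing one. -/
theorem _root_.REPred.exists_computable_stages {α : Type*} [Primcodable α] {P : α → Prop}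
    (hP : REPred P) : ∃ R : α × ℕ → Prop, ComputablePred R ∧ (∀ a, P a ↔ ∃ s, R (a, s)) ∧
      (∀ a s t, s ≤ t → R (a, s) → R (a, t)) ∧ ∀ a, ¬ R (a, 0) := by
  obtain ⟨c, hc⟩ := Nat.Partrec.Code.exists_code.1 (show Nat.Partrec _ from hP)
  refine ⟨fun q => (Nat.Partrec.Code.evaln q.2 c (Encodable.encode q.1)).isSome = true, ?_, ?_,
    ?_, ?_⟩
  · have : Primrec fun q : α × ℕ => (Nat.Partrec.Code.evaln q.2 c (Encodable.encode q.1)).isSome :=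
      Primrec.option_isSome.comp (Nat.Partrec.Code.primrec_evaln.comp
        ((Primrec.snd.pair (Primrec.const c)).pair (Primrec.encode.comp Primrec.fst)))
    exact (Primrec.eq.comp this (Primrec.const true)).computablePred
  · intro a
    have h : P a ↔ (Nat.Partrec.Code.eval c (Encodable.encode a)).Dom := by
      rw [hc]; simp only [Encodable.encodek, Part.coe_some, Part.bind_some, Part.map_Dom]
      exact ⟨fun h => ⟨h, trivial⟩, fun h => h.1⟩
    rw [h, Part.dom_iff_mem]
    simp only [Nat.Partrec.Code.evaln_complete, Option.isSome_iff_exists]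
    exact exists_comm
  · intro a s t hst h
    obtain ⟨x, hx⟩ := Option.isSome_iff_exists.1 h
    exact Option.isSome_iff_exists.2 ⟨x, Nat.Partrec.Code.evaln_mono hst hx⟩
  · intro a; simp [Nat.Partrec.Code.evaln]

/-- Dovetailing: a witness and a stage confirming it are searched for together. -/
theorem _root_.REPred.exists_partrec_choice {α β : Type*} [Primcodable α] [Primcodable β]
    {P : α × β → Prop} (hP : REPred P) :
    ∃ f : α →. β, Partrec f ∧ (∀ a, ∀ b ∈ f a, P (a, b)) ∧ ∀ a b, P (a, b) → (f a).Dom := by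
  obtain ⟨R, hR, hPR, -, -⟩ := hP.exists_computable_stages
  have hR' : ComputablePred fun q : α × β × ℕ => R ((q.1, q.2.1), q.2.2) := by
    obtain ⟨_, hR⟩ := hR
    exact ⟨fun q => inferInstance, hR.comp ((Computable.fst.pair
      (Computable.fst.comp Computable.snd)).pair (Computable.snd.comp Computable.snd))⟩
  obtain ⟨f, hf, h1, h2⟩ := hR'.exists_partrec_choice
  refine ⟨fun a => (f a).map Prod.fst, hf.map (Computable.fst.comp Computable.snd), ?_, ?_⟩
  · intro a b hb
    obtain ⟨q, hq, rfl⟩ := (Part.mem_map_iff _).1 hb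
    exact (hPR _).2 ⟨_, h1 a q hq⟩
  · intro a b hb
    obtain ⟨s, hs⟩ := (hPR _).1 hb
    exact h2 a (b, s) hs

theorem _root_.REPred.exists_mem {α β : Type*} [Primcodable α] [Primcodable β] {f : α →. β}
    (hf : Partrec f) {P : α × β → Prop} (hP : REPred P) :
    REPred fun a => ∃ b ∈ f a, P (a, b) := by
  have h : Partrec₂ fun a b => Part.assert (P (a, b)) fun _ => Part.some () := hP
  refine (Partrec.dom_re (hf.bind h)).of_eq fun a => ⟨?_, ?_⟩
  · rintro ⟨hd, h⟩
    exact ⟨_, Part.get_mem hd, h.1⟩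
  · rintro ⟨_, ⟨hd, rfl⟩, h⟩
    exact ⟨hd, h, trivial⟩

theorem _root_.ComputablePred.exists_computable_choice {α β : Type*} [Primcodable α]
    [Primcodable β] {P : α × β → Prop} (hP : ComputablePred P) (h : ∀ a, ∃ b, P (a, b)) :
    ∃ f : α → β, Computable f ∧ ∀ a, P (a, f a) := by
  obtain ⟨f, hf, h1, h2⟩ := hP.exists_partrec_choice
  have hd : ∀ a, (f a).Dom := fun a => let ⟨b, hb⟩ := h a; h2 a b hb
  exact ⟨fun a => (f a).get (hd a), hf.of_eq_tot fun a => Part.get_mem _,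
    fun a => h1 a _ (Part.get_mem _)⟩

-- Each element is found by searching upward from its predecessor; infinitude makes every search
-- stop.
open scoped Classical in
theorem computable_nth {p : ℕ → Prop} (hp : ComputablePred p) (hi : (Set.ofPred p).Infinite) :
    Computable (Nat.nth p) := by
  have hex : ∀ m, ∃ n, m ≤ n ∧ p n := fun m =>
    let ⟨n, hn, hm⟩ := hi.exists_gt m; ⟨n, hm.le, hn⟩
  have hP : ComputablePred fun q : ℕ × ℕ => q.1 ≤ q.2 ∧ p q.2 := by
    have h1 : Computable fun q : ℕ × ℕ => decide (q.1 ≤ q.2) := Primrec.nat_le.decide.to_comp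
    have h2 : Computable fun q : ℕ × ℕ => decide (p q.2) := hp.decide.comp Computable.snd
    exact Computable.computablePred ((Primrec.and.to_comp.comp h1 h2).of_eq fun q => by simp)
  have hf := Computable.find (P := fun m n => m ≤ n ∧ p n) hP hex
  set F : ℕ → ℕ := fun m => Nat.find (hex m) with hF
  refine (Computable.nat_rec (f := fun n : ℕ => n) (g := fun _ => F 0)
    (h := fun _ q => F (q.2 + 1)) Computable.id (Computable.const _)
    (hf.comp (Computable.succ.comp (Computable.snd.comp Computable.snd)))).of_eq fun n => ?_
  induction n with
  | zero =>
    refine le_antisymm (Nat.find_min' _ ⟨Nat.zero_le _, Nat.nth_mem_of_infinite hi 0⟩) ?_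
    rw [Nat.nth_zero]
    exact Nat.sInf_le (Nat.find_spec (hex 0)).2
  | succ n ih =>
    change F (_ + 1) = _
    rw [ih]
    refine le_antisymm (Nat.find_min' _ ⟨Nat.nth_strictMono hi n.lt_succ_self,
      Nat.nth_mem_of_infinite hi _⟩) ?_
    by_contra hlt
    have hs := Nat.find_spec (hex (Nat.nth p n + 1))
    exact absurd (Nat.le_nth_of_lt_nth_succ (not_le.1 hlt) hs.2) (not_le.2 hs.1)

/-- An infinite recursively enumerable set has a computable enumeration without repetitions. -/
theorem _root_.REPred.exists_injective_enumeration {P : ℕ → Prop} (hP : REPred P)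
    (hi : (Set.ofPred P).Infinite) :
    ∃ e : ℕ → ℕ, Computable e ∧ Function.Injective e ∧ range e = Set.ofPred P := by
  obtain ⟨R, hR, hPR, hmono, h0⟩ := hP.exists_computable_stages
  -- T holds of the pairs (N, s) with s the first stage at which N is confirmed, so each N of the
  -- set occurs exactly once. Nothing is confirmed at stage 0, so `s - 1` is a genuine earlier
  -- stage.
  let T : ℕ → Prop := fun t => R (t.unpair.1, t.unpair.2) ∧ ¬ R (t.unpair.1, t.unpair.2 - 1)
  have hT : ComputablePred T := by
    obtain ⟨_, hR⟩ := hR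
    have u1 : Computable fun t : ℕ => t.unpair.1 := Computable.fst.comp Computable.unpair
    have u2 : Computable fun t : ℕ => t.unpair.2 := Computable.snd.comp Computable.unpair
    refine Computable.computablePred ((Primrec.and.to_comp.comp (hR.comp (u1.pair u2))
      (Primrec.not.to_comp.comp (hR.comp (u1.pair (Computable.pred.comp u2))))).of_eq fun t => ?_)
    simp [T]
  have hinj : ∀ t u, T t → T u → t.unpair.1 = u.unpair.1 → t = u := by
    intro t u ht hu h
    have key : ∀ t u : ℕ, T t → T u → t.unpair.1 = u.unpair.1 → t.unpair.2 ≤ u.unpair.2 := by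
      intro t u ht hu h
      by_contra hlt
      exact ht.2 (hmono _ _ _ (by omega) (h ▸ hu.1))
    rw [← Nat.pair_unpair t, ← Nat.pair_unpair u, h,
      le_antisymm (key t u ht hu h) (key u t hu ht h.symm)]
  have hsurj : ∀ N, P N → ∃ t, T t ∧ t.unpair.1 = N := by
    classical
    intro N hN
    have hex := (hPR N).1 hN
    refine ⟨Nat.pair N (Nat.find hex), ⟨by simpa using Nat.find_spec hex, ?_⟩, by simp⟩
    simp only [Nat.unpair_pair]
    refine Nat.find_min hex (Nat.sub_lt (Nat.pos_of_ne_zero fun h => ?_) one_pos)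
    exact h0 N (h ▸ Nat.find_spec hex)
  have hTi : (Set.ofPred T).Infinite := by
    intro hfin
    refine hi ((hfin.image fun t => t.unpair.1).subset fun N hN => ?_)
    obtain ⟨t, ht, h⟩ := hsurj N hN
    exact ⟨t, ht, h⟩
  refine ⟨fun n => (Nat.nth T n).unpair.1,
    Computable.fst.comp (Computable.unpair.comp (computable_nth hT hTi)), fun a b hab => ?_, ?_⟩
  · exact Nat.nth_injective hTi (hinj _ _ (Nat.nth_mem_of_infinite hTi _)
      (Nat.nth_mem_of_infinite hTi _) hab)
  · ext N
    constructor
    · rintro ⟨n, rfl⟩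
      exact (hPR _).2 ⟨_, (Nat.nth_mem_of_infinite hTi n).1⟩
    · intro hN
      obtain ⟨t, ht, h⟩ := hsurj N hN
      have : t ∈ range (Nat.nth T) := by rw [Nat.range_nth_of_infinite hTi]; exact ht
      obtain ⟨n, rfl⟩ := this
      exact ⟨n, h⟩

/-- Programs for the sections of a partial recursive function can be computed. -/
theorem _root_.Partrec.exists_code_sections {α σ : Type*} [Primcodable α] [Primcodable σ]
    {φ : α × ℕ →. σ} (hφ : Partrec φ) :
    ∃ s : α → Nat.Partrec.Code, Computable s ∧
      ∀ a n, (s a).eval n = (φ (a, n)).map Encodable.encode := by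
  obtain ⟨c, hc⟩ := Nat.Partrec.Code.exists_code.1 (show Nat.Partrec _ from hφ)
  refine ⟨fun a => c.curry (Encodable.encode a), (Nat.Partrec.Code.primrec₂_curry.comp
    (Primrec.const c) Primrec.encode).to_comp, fun a n => ?_⟩
  have : Nat.pair (Encodable.encode a) n = Encodable.encode (a, n) := rfl
  rw [Nat.Partrec.Code.eval_curry, hc, this]
  simp

/-! ### Approximations of constructive real numbers -/

/-- A rational approximation with accuracy `2⁻ⁿ` to the real number with a given code. -/
def RealCode.approx (q : RealCode × ℕ) : Part RatCode :=
  (q.1.2.eval q.2).bind fun b => (q.1.1.eval b).bind fun m => ↑(Encodable.decode m : Option RatCode)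

theorem RealCode.partrec_approx : Partrec RealCode.approx := by
  have e := Nat.Partrec.Code.eval_part
  refine Partrec.bind (e.comp (Computable.snd.comp Computable.fst) Computable.snd) ?_
  refine Partrec.bind (e.comp (Computable.fst.comp (Computable.fst.comp Computable.fst))
    Computable.snd) ?_
  exact Computable.ofOption (Computable.decode.comp Computable.snd)

/-- The term at the index given by the regulator is close to all later terms; passing to the limit
weakens `<` to `≤`. -/
theorem RealCode.Represents.exists_approx {c : RealCode} {x : ℝ} (h : c.Represents x) (n : ℕ) :
    ∃ r ∈ RealCode.approx (c, n), |(r.val : ℝ) - x| ≤ (1 / 2) ^ n := by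
  obtain ⟨a, b, ha, hb, hab, hx⟩ := h
  refine ⟨a (b n), ?_, ?_⟩
  · refine Part.mem_bind_iff.2 ⟨_, hb n, Part.mem_bind_iff.2 ⟨_, ha _, ?_⟩⟩
    exact Part.mem_ofOption.2 (Encodable.encodek _)
  · have h1 : Tendsto (fun i => |((a (b n)).val : ℝ) - (a i).val|) atTop
        (𝓝 |((a (b n)).val : ℝ) - x|) := (tendsto_const_nhds.sub hx).abs
    refine le_of_tendsto h1 ((eventually_ge_atTop (b n)).mono fun i hi => ?_)
    have := (hab n (b n) i le_rfl hi).le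
    have h2 : ((|(a (b n)).val - (a i).val| : ℚ) : ℝ) ≤ ((1 / 2 : ℚ) ^ n : ℚ) := by
      exact_mod_cast this
    push_cast at h2
    exact h2

/-- A function with algorithmically computable approximations is constructive. -/
theorem isConstructiveFunction_of_approx {f : UnitPoint → ℝ} {φ : RealCode × ℕ →. RatCode}
    (hφ : Partrec φ) (h : ∀ (c : RealCode) (x : UnitPoint), c.Represents x.1 → ∀ n,
      ∃ r ∈ φ (c, n), |(r.val : ℝ) - f x| ≤ (1 / 2) ^ n) : IsConstructiveFunction f := by
  obtain ⟨s, hs, hsφ⟩ := hφ.exists_code_sections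
  -- Two approximations of accuracy 2^-(n+2) differ by at most 2^-(n+1), strictly less than 2^-n.
  have hreg : Nat.Partrec fun n : ℕ => (Part.some (n + 2) : Part ℕ) :=
    Partrec.nat_iff.1 (Primrec.nat_add.comp Primrec.id (Primrec.const 2)).to_comp.partrec
  obtain ⟨e, he⟩ := Nat.Partrec.Code.exists_code.1 hreg
  refine ⟨fun c => Part.some (s c, e), (hs.pair (Computable.const e)).partrec, fun c x hc =>
    ⟨_, Part.mem_some _, ?_⟩⟩
  choose a ha hax using h c x hc
  refine ⟨a, fun n => n + 2, fun n => ?_, fun n => ?_, fun n i j hi hj => ?_, ?_⟩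
  · rw [hsφ]; exact Part.mem_map _ (ha n)
  · rw [he]; exact Part.mem_some _
  · have hp : ∀ i, n + 2 ≤ i → |((a i).val : ℝ) - f x| ≤ (1 / 2) ^ (n + 2) := fun i hi =>
      (hax i).trans (pow_le_pow_of_le_one (by norm_num) (by norm_num) hi)
    have h1 := abs_sub_le ((a i).val : ℝ) (f x) (a j).val
    rw [abs_sub_comm (f x)] at h1
    have h2 : |((a i).val : ℝ) - (a j).val| < (1 / 2) ^ n := by
      have := hp i hi
      have := hp j hj
      have h3 : (0 : ℝ) < (1 / 2) ^ n := by positivity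
      rw [pow_add] at *
      linarith
    have h3 : ((|(a i).val - (a j).val| : ℚ) : ℝ) < ((1 / 2 : ℚ) ^ n : ℚ) := by
      push_cast; exact h2
    exact_mod_cast h3
  · rw [tendsto_iff_dist_tendsto_zero]
    refine squeeze_zero (fun _ => dist_nonneg) (fun i => ?_)
      (tendsto_pow_atTop_nhds_zero_of_lt_one (r := (1 / 2 : ℝ)) (by norm_num) (by norm_num))
    rw [Real.dist_eq]; exact hax i

/-- A crude natural upper bound that can be read off the code and serves in place of a ceiling. -/
theorem RatCode.val_le_fst (r : RatCode) : r.val ≤ r.1 := by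
  rw [RatCode.val, div_le_iff₀ (by positivity)]
  have : (0 : ℚ) ≤ r.2.1 := by positivity
  have : (0 : ℚ) ≤ r.1 * r.2.2 := by positivity
  linarith

theorem exists_computable_sum {α : Type*} [Primcodable α] {B : α × ℕ → RatCode}
    (hB : Computable B) {m : α → ℕ} (hm : Computable m) : ∃ S : α → RatCode, Computable S ∧
      ∀ a, (S a).val = ∑ k ∈ Finset.range (m a), (B (a, k)).val := by
  refine ⟨fun a => Nat.rec (RatCode.ofNat 0) (fun k s => s.add (B (a, k))) (m a),
    Computable.nat_rec (g := fun _ => RatCode.ofNat 0)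
      (h := fun a q => q.2.add (B (a, q.1))) hm (Computable.const _) ?_, fun a => ?_⟩
  · exact RatCode.primrec_add.to_comp.comp (Computable.snd.comp Computable.snd)
      (hB.comp (Computable.fst.pair (Computable.fst.comp Computable.snd)))
  · beta_reduce
    induction m a with
    | zero => simp [RatCode.val_ofNat]
    | succ k ih => rw [Finset.sum_range_succ, ← ih, ← RatCode.val_add]

/-! ### Convergence and constructivity of the sum of bumps -/

namespace Construction

variable {A : ℕ → ℕ →. Output} (C : Construction A)

theorem admissible (n : ℕ) : Output.Admissible (C.δ n, C.g n) := by
  have : C.μ n ∈ range C.μ := mem_range_self n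
  rw [C.μ_range] at this
  obtain ⟨o, ho, h⟩ := this
  rwa [Part.mem_unique (C.result n) ho]

theorem h_le {m n : ℕ} (hmn : m ≤ n) (x : UnitPoint) : (C.h m).eval x.1 ≤ (C.h n).eval x.1 :=
  monotone_nat_of_le_succ (f := fun n => (C.h n).eval x.1) (fun n => C.h_mono n x) hmn

theorem β_pos_real (n : ℕ) : (0 : ℝ) < (C.β n).val := by exact_mod_cast C.β_pos n

/-- The closed interval on which the `n`-th bump lives. -/
def support (n : ℕ) : Set ℝ :=
  Icc (((C.ζ n).val - (C.β n).val : ℚ) : ℝ) (((C.ζ n).val + (C.β n).val : ℚ) : ℝ)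

/-- If i < j, then h_{ν(i+1)} > 1 on the i-th support, while h_{ν(j)} ≥ h_{ν(i+1)} is below 1 on the
j-th because g_j ≥ 0. -/
theorem eq_of_mem_support {i j : ℕ} {x : UnitPoint} (hi : x.1 ∈ C.support i)
    (hj : x.1 ∈ C.support j) : i = j := by
  have key : ∀ i j : ℕ, x.1 ∈ C.support i → x.1 ∈ C.support j → ¬ i < j := by
    intro i j hi hj hij
    have h1 := (C.separation i x hi).2
    have h2 := (C.separation j x hj).1
    have h3 := C.h_le (C.ν_strictMono.monotone (Nat.succ_le_of_lt hij)) x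
    have h4 := (C.admissible j).2.2.1 x
    simp only at h4
    linarith
  exact le_antisymm (not_lt.1 (key j i hj hi)) (not_lt.1 (key i j hi hj))

theorem bump_nonneg (n : ℕ) (x : ℝ) : 0 ≤ C.bump n x :=
  mul_nonneg (by positivity) (le_max_left _ _)

theorem bump_eq_zero {n : ℕ} {x : ℝ} (h : ((C.β n).val : ℝ) ≤ |x - (C.ζ n).val|) :
    C.bump n x = 0 := by
  rw [bump, max_eq_left, mul_zero]
  rw [sub_nonpos]
  exact (one_le_div (C.β_pos_real n)).2 h

theorem mem_support_of_bump_ne_zero {n : ℕ} {x : ℝ} (h : C.bump n x ≠ 0) : x ∈ C.support n := by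
  have h1 : |x - (C.ζ n).val| < (C.β n).val := by
    by_contra h1
    exact h (C.bump_eq_zero (not_lt.1 h1))
  rw [abs_lt] at h1
  unfold support
  push_cast
  constructor <;> linarith

/-- On the n-th support h_{ν(n)} < 1, and ν(n) ≥ n ≥ m. Thus h_m(x) > 1 is a finite certificate for
truncating the series at m. -/
theorem bump_eq_zero_of_one_lt {m n : ℕ} (hmn : m ≤ n) {x : UnitPoint}
    (h : 1 < (C.h m).eval x.1) : C.bump n x.1 = 0 := by
  by_contra h0
  have h1 := (C.separation n x (C.mem_support_of_bump_ne_zero h0)).1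
  have h2 := C.h_le (hmn.trans (C.ν_strictMono.le_apply (x := n))) x
  have h3 := (C.admissible n).2.2.1 x
  simp only at h3
  linarith

theorem hasSum_bump {m : ℕ} {x : UnitPoint} (h : 1 < (C.h m).eval x.1) :
    HasSum (fun k => C.bump k x.1) (∑ k ∈ Finset.range m, C.bump k x.1) :=
  hasSum_sum_of_ne_finset_zero fun k hk =>
    C.bump_eq_zero_of_one_lt (by simpa using hk) h

theorem exists_one_lt (x : UnitPoint) : ∃ m, 1 < (C.h m).eval x.1 :=
  ((C.h_tendsto x).eventually (lt_mem_nhds (by norm_num : (1 : ℝ) < 2))).exists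

/-- The sum of the bumps. -/
noncomputable def sum (x : UnitPoint) : ℝ := ∑' k, C.bump k x.1

theorem hasSum_sum (x : UnitPoint) : HasSum (fun k => C.bump k x.1) (C.sum x) :=
  let ⟨_, hm⟩ := C.exists_one_lt x
  (C.hasSum_bump hm).summable.hasSum

theorem abs_bump_sub_le (n : ℕ) (x y : ℝ) :
    |C.bump n x - C.bump n y| ≤ ((C.β n).val : ℝ)⁻¹ * |x - y| := by
  have hβ := C.β_pos_real n
  rw [bump, bump, ← mul_sub, abs_mul]
  have h1 : |(1 / 2 : ℝ) ^ C.μ n| ≤ 1 := by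
    rw [abs_of_nonneg (by positivity)]
    exact pow_le_one₀ (by norm_num) (by norm_num)
  have h2 := abs_max_sub_max_le_abs (1 - |x - (C.ζ n).val| / (C.β n).val)
    (1 - |y - (C.ζ n).val| / (C.β n).val) (0 : ℝ)
  rw [max_comm _ (0 : ℝ), max_comm _ (0 : ℝ)] at h2
  have h3 : |(1 - |x - ((C.ζ n).val : ℝ)| / (C.β n).val) -
      (1 - |y - ((C.ζ n).val : ℝ)| / (C.β n).val)| ≤ ((C.β n).val : ℝ)⁻¹ * |x - y| := by
    rw [sub_sub_sub_cancel_left, ← sub_div, abs_div, abs_of_pos hβ, div_eq_inv_mul]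
    refine mul_le_mul_of_nonneg_left ?_ (by positivity)
    refine (abs_abs_sub_abs_le_abs_sub _ _).trans ?_
    rw [sub_sub_sub_cancel_right, abs_sub_comm]
  calc _ ≤ 1 * (((C.β n).val : ℝ)⁻¹ * |x - y|) :=
        mul_le_mul h1 (h2.trans h3) (abs_nonneg _) zero_le_one
    _ = _ := one_mul _

theorem exists_computable_bump : ∃ B : RatCode × ℕ → RatCode, Computable B ∧
    ∀ q, ((B q).val : ℝ) = C.bump q.2 q.1.val := by
  have hr : PrimrecRat fun p : RatCode × ℕ × RatCode × RatCode => p.1.val := .val Primrec.fst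
  have hz : PrimrecRat fun p : RatCode × ℕ × RatCode × RatCode => p.2.2.1.val :=
    .val (Primrec.fst.comp (Primrec.snd.comp Primrec.snd))
  have hb : PrimrecRat fun p : RatCode × ℕ × RatCode × RatCode => p.2.2.2.val :=
    .val (Primrec.snd.comp (Primrec.snd.comp Primrec.snd))
  obtain ⟨F, hF, e⟩ := (PrimrecRat.pow (α := RatCode × ℕ × RatCode × RatCode) (.const (1 / 2))
    (Primrec.fst.comp Primrec.snd)).mul ((PrimrecRat.const 0).max
      ((PrimrecRat.const 1).sub ((hr.sub hz).abs.div hb)))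
  refine ⟨fun q => F (q.1, C.μ q.2, C.ζ q.2, C.β q.2), hF.to_comp.comp (Computable.fst.pair
    ((C.μ_computable.comp Computable.snd).pair ((C.ζ_computable.comp Computable.snd).pair
      (C.β_computable.comp Computable.snd)))), fun q => ?_⟩
  rw [e, bump]
  push_cast
  rfl

/-- A strict inequality at a real point is semidecidable: search for m and a precision j at which an
approximation of x gives a value exceeding 1 by more than the possible Lipschitz error. The m found
may depend on the code of x. -/
theorem exists_partrec_one_lt : ∃ f : RealCode →. ℕ, Partrec f ∧
    ∀ (c : RealCode) (x : UnitPoint), c.Represents x.1 → ∃ m ∈ f c, 1 < (C.h m).eval x.1 := by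
  -- The approximation is clamped to [0, 1]: the Lipschitz bound fails to the right of 1, and
  -- clamping brings it no further from x.
  let Q : ℕ × PolyCode × RatCode → Prop := fun q => 1 + q.2.1.lip * (1 / 2) ^ q.1 <
    q.2.1.evalRat (max 0 (min 1 q.2.2.val))
  have hQ : PrimrecPred Q := by
    have hr : PrimrecRat fun q : ℕ × PolyCode × RatCode => max 0 (min 1 q.2.2.val) :=
      (PrimrecRat.const 0).max ((PrimrecRat.const 1).min (.val (Primrec.snd.comp Primrec.snd)))
    have hL : Primrec fun q : ℕ × PolyCode × RatCode => q.2.1 := Primrec.fst.comp Primrec.snd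
    refine PrimrecRat.lt ((PrimrecRat.const 1).add ((PolyCode.primrecRat_lip.comp hL).mul
      ((PrimrecRat.const _).pow Primrec.fst))) ?_
    obtain ⟨R, hR, e⟩ := hr
    exact (PolyCode.primrecRat_evalRat.comp (hL.pair hR)).of_eq fun q => by rw [e]
  let P : RealCode × ℕ × ℕ → Prop := fun q =>
    ∃ r ∈ RealCode.approx (q.1, q.2.1), Q (q.2.1, C.h q.2.2, r)
  have hP : REPred P := by
    have h1 : REPred fun p : (RealCode × ℕ × ℕ) × RatCode => Q (p.1.2.1, C.h p.1.2.2, p.2) := by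
      refine (hQ.comp_computable ?_).to_re
      exact (Computable.fst.comp (Computable.snd.comp Computable.fst)).pair
        ((C.h_computable.comp (Computable.snd.comp (Computable.snd.comp Computable.fst))).pair
          Computable.snd)
    have h2 : Partrec fun q : RealCode × ℕ × ℕ => RealCode.approx (q.1, q.2.1) :=
      RealCode.partrec_approx.comp (Computable.fst.pair (Computable.fst.comp Computable.snd))
    exact REPred.exists_mem h2 h1
  obtain ⟨f, hf, h1, h2⟩ := hP.exists_partrec_choice
  have close : ∀ (x : UnitPoint) (r : RatCode),
      |((max 0 (min 1 r.val) : ℚ) : ℝ) - x.1| ≤ |(r.val : ℝ) - x.1| := by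
    intro x r
    push_cast
    have h1 := abs_max_sub_max_le_abs (min 1 (r.val : ℝ)) (min 1 x.1) 0
    rw [max_comm, max_comm _ (0 : ℝ), min_eq_right x.2.1.2, max_eq_right x.2.1.1] at h1
    have h2 := abs_min_sub_min_le_max 1 (r.val : ℝ) 1 x.1
    rw [min_eq_right x.2.1.2, sub_self, abs_zero, max_eq_right (abs_nonneg _)] at h2
    exact h1.trans h2
  refine ⟨fun c => (f c).map Prod.snd, hf.map (Computable.snd.comp Computable.snd),
    fun c x hc => ?_⟩
  have hex : ∃ q : ℕ × ℕ, P (c, q) := by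
    obtain ⟨m, hm⟩ := C.exists_one_lt x
    -- The factor 2 pays once for the margin in `Q` and once for the error of the approximation.
    have ht : Tendsto (fun j : ℕ => 1 + 2 * ((C.h m).lip : ℝ) * (1 / 2) ^ j) atTop
        (𝓝 (1 + 2 * ((C.h m).lip : ℝ) * 0)) :=
      tendsto_const_nhds.add (tendsto_const_nhds.mul
        (tendsto_pow_atTop_nhds_zero_of_lt_one (by norm_num) (by norm_num)))
    rw [mul_zero, add_zero] at ht
    obtain ⟨j, hj⟩ := (ht.eventually (gt_mem_nhds hm)).exists
    obtain ⟨r, hr, hrx⟩ := hc.exists_approx j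
    refine ⟨(j, m), r, hr, ?_⟩
    have h3 := (C.h_polygonal m).abs_sub_le x.2.1.2
      (show ((max 0 (min 1 r.val) : ℚ) : ℝ) ≤ 1 by push_cast; simp)
    rw [abs_sub_comm x.1] at h3
    have h4 := mul_le_mul_of_nonneg_left ((close x r).trans hrx)
      (show (0 : ℝ) ≤ (C.h m).lip by exact_mod_cast (C.h m).lip_nonneg)
    have h5 : (((1 : ℚ) + (C.h m).lip * (1 / 2) ^ j : ℚ) : ℝ) <
        (((C.h m).evalRat (max 0 (min 1 r.val)) : ℚ) : ℝ) := by
      rw [PolyCode.cast_evalRat]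
      push_cast at h3 h4 ⊢
      linarith [(abs_le.1 h3).2]
    exact_mod_cast h5
  obtain ⟨q, hq⟩ := hex
  have hd := h2 c q hq
  refine ⟨_, Part.mem_map _ (Part.get_mem hd), ?_⟩
  obtain ⟨r, hr, hQr⟩ := h1 c _ (Part.get_mem hd)
  generalize (f c).get hd = p at *
  obtain ⟨r', hr', hrx⟩ := hc.exists_approx p.1
  obtain rfl := Part.mem_unique hr hr'
  have h3 := (C.h_polygonal p.2).abs_sub_le x.2.1.2
    (show ((max 0 (min 1 r.val) : ℚ) : ℝ) ≤ 1 by push_cast; simp)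
  rw [abs_sub_comm x.1] at h3
  have h4 := mul_le_mul_of_nonneg_left ((close x r).trans hrx)
    (show (0 : ℝ) ≤ (C.h p.2).lip by exact_mod_cast (C.h p.2).lip_nonneg)
  have h5 : (((1 : ℚ) + (C.h p.2).lip * (1 / 2) ^ p.1 : ℚ) : ℝ) <
      (((C.h p.2).evalRat (max 0 (min 1 r.val)) : ℚ) : ℝ) := by
    exact_mod_cast hQr
  rw [PolyCode.cast_evalRat] at h5
  push_cast at h3 h4 h5
  linarith [(abs_le.1 h3).1]

theorem isConstructiveFunction_sum : IsConstructiveFunction C.sum := by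
  obtain ⟨f, hf, hfm⟩ := C.exists_partrec_one_lt
  obtain ⟨B, hB, eB⟩ := C.exists_computable_bump
  obtain ⟨S, hS, eS⟩ := exists_computable_sum (α := RatCode × ℕ) (B := fun q => B (q.1.1, q.2))
    (m := Prod.snd) (hB.comp ((Computable.fst.comp Computable.fst).pair Computable.snd))
    Computable.snd
  obtain ⟨K, hK, eK⟩ := exists_computable_sum (α := ℕ) (B := fun q => (C.β q.2).inv) (m := id)
    (RatCode.primrec_inv.to_comp.comp (C.β_computable.comp Computable.snd)) Computable.id
  -- The slopes add up to at most the sum of the 1/β_k. Bounding it by a power of two lets `(K m).1`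
  -- extra binary digits of x compensate for it.
  have lipschitz : ∀ (m : ℕ) (x y : ℝ), |∑ k ∈ Finset.range m, C.bump k x -
      ∑ k ∈ Finset.range m, C.bump k y| ≤ 2 ^ (K m).1 * |x - y| := by
    intro m x y
    rw [← Finset.sum_sub_distrib]
    refine (Finset.abs_sum_le_sum_abs _ _).trans
      ((Finset.sum_le_sum fun k _ => C.abs_bump_sub_le k x y).trans ?_)
    rw [← Finset.sum_mul]
    refine mul_le_mul_of_nonneg_right ?_ (abs_nonneg _)
    have h1 : (∑ k ∈ Finset.range m, ((C.β k).val : ℝ)⁻¹) = (K m).val := by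
      rw [eK]; push_cast; simp [RatCode.val_inv]
    rw [h1]
    have h2 : ((K m).val : ℝ) ≤ (K m).1 := by exact_mod_cast (K m).val_le_fst
    exact h2.trans (by exact_mod_cast (Nat.lt_two_pow_self (n := (K m).1)).le)
  refine isConstructiveFunction_of_approx (φ := fun q => (f q.1).bind fun m =>
    (RealCode.approx (q.1, q.2 + (K m).1)).map fun r => S (r, m)) ?_ fun c x hc n => ?_
  · refine Partrec.bind (hf.comp Computable.fst) (Partrec.map (RealCode.partrec_approx.comp
      ((Computable.fst.comp Computable.fst).pair (Primrec.nat_add.to_comp.comp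
        (Computable.snd.comp Computable.fst)
        (Computable.fst.comp (hK.comp Computable.snd))))) ?_)
    exact hS.comp (Computable.snd.pair (Computable.snd.comp Computable.fst))
  · obtain ⟨m, hm, hmx⟩ := hfm c x hc
    obtain ⟨r, hr, hrx⟩ := hc.exists_approx (n + (K m).1)
    refine ⟨S (r, m), Part.mem_bind_iff.2 ⟨m, hm, Part.mem_map _ hr⟩, ?_⟩
    rw [(C.hasSum_sum x).unique (C.hasSum_bump hmx), eS]
    push_cast
    simp only [eB]
    refine (lipschitz m _ _).trans ((mul_le_mul_of_nonneg_left hrx (by positivity)).trans ?_)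
    rw [pow_add, mul_left_comm, ← mul_pow]
    norm_num

end Construction

/-! ### The diagonal argument against integrability -/

/-- The interpolant is a convex combination of two nodal values of F, each taken within one mesh
width of x. -/
theorem PolyCode.abs_eval_grid_sub_le {n : ℕ} {v : ℕ → RatCode} {F : ℝ → ℝ} {K : ℝ} (hK : 0 ≤ K)
    (hF : ∀ x ≤ 1, ∀ y ≤ 1, |F x - F y| ≤ K * |x - y|)
    (hv : ∀ k ≤ n + 1, ((v k).val : ℝ) = F (k / (n + 1))) {x : ℝ} (hx : x ∈ Icc (0 : ℝ) 1) :
    |(grid n v).eval x - F x| ≤ K / (n + 1) := by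
  obtain ⟨k, hk, h1, h2⟩ := exists_cell n hx
  have hn : (0 : ℝ) < n + 1 := by positivity
  have hkn : (k : ℝ) ≤ n := by exact_mod_cast hk
  rw [eval_grid v hk h1 h2, hv k (by omega), hv (k + 1) (by omega)]
  have near : ∀ y : ℝ, y ≤ 1 → |(n + 1) * y - (n + 1) * x| ≤ 1 → |F y - F x| ≤ K / (n + 1) := by
    intro y hy h
    refine (hF y hy x hx.2).trans ?_
    rw [div_eq_mul_inv]
    refine mul_le_mul_of_nonneg_left ?_ hK
    rw [← mul_sub, abs_mul, abs_of_pos hn] at h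
    rw [inv_eq_one_div, le_div_iff₀ hn]; linarith
  have e1 : |F (((k + 1 : ℕ) : ℝ) / (n + 1)) - F x| ≤ K / (n + 1) := by
    refine near _ ?_ ?_
    · rw [div_le_one hn]; push_cast; linarith
    · rw [mul_div_cancel₀ _ hn.ne']; push_cast; rw [abs_le]; constructor <;> linarith
  have e2 : |F ((k : ℝ) / (n + 1)) - F x| ≤ K / (n + 1) := by
    refine near _ ?_ ?_
    · rw [div_le_one hn]; linarith
    · rw [mul_div_cancel₀ _ hn.ne', abs_le]; constructor <;> linarith
  set t := (n + 1) * x - k with ht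
  have : F (((k + 1 : ℕ) : ℝ) / (n + 1)) * t + F ((k : ℝ) / (n + 1)) * (k + 1 - (n + 1) * x) - F x =
      t * (F (((k + 1 : ℕ) : ℝ) / (n + 1)) - F x) + (1 - t) * (F ((k : ℝ) / (n + 1)) - F x) := by
    rw [ht]; ring
  rw [this]
  have t0 : 0 ≤ t := by linarith
  have t1 : 0 ≤ 1 - t := by linarith
  refine (abs_add_le _ _).trans ?_
  rw [abs_mul, abs_mul, abs_of_nonneg t0, abs_of_nonneg t1]
  nlinarith [mul_le_mul_of_nonneg_left e1 t0, mul_le_mul_of_nonneg_left e2 t1]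

/-- From an index `N` and polygonal bounds `D ≤ U` one computes `δ` and a polygonal
approximation of `2 ^ (N + 1) (U - D)`. -/
theorem exists_primrec_rescaled_gap : ∃ ψ : ℕ × PolyCode × PolyCode → Output, Primrec ψ ∧
    ∀ (N : ℕ) (D U : PolyCode), D.IsPolygonal → U.IsPolygonal →
      (∀ x : UnitPoint, D.eval x.1 ≤ U.eval x.1) →
      U.integral - D.integral < (1 / 2) ^ (N + 3) →
      (ψ (N, D, U)).Admissible ∧ (D.lip + 1) * (ψ (N, D, U)).1.val = (1 / 2) ^ (N + 2) ∧
      ∀ x ∈ Icc (0 : ℝ) 1, (2 : ℝ) ^ (N + 1) * (U.eval x - D.eval x) - 1 / 8 ≤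
        (ψ (N, D, U)).2.eval x := by
  have pN : Primrec fun q : ℕ × PolyCode × PolyCode => q.1 := Primrec.fst
  have pD : Primrec fun q : ℕ × PolyCode × PolyCode => q.2.1 := Primrec.fst.comp Primrec.snd
  have pU : Primrec fun q : ℕ × PolyCode × PolyCode => q.2.2 := Primrec.snd.comp Primrec.snd
  have lD := PolyCode.primrecRat_lip.comp pD
  have lU := PolyCode.primrecRat_lip.comp pU
  -- Over a distance δ = 2^-(N+2) / (lip D + 1), D varies by at most 2^-N/4; the `+ 1` avoids
  -- division by zero.
  obtain ⟨δ, hδ, eδ⟩ := ((PrimrecRat.const (1 / 2)).pow (Primrec.nat_add.comp pN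
    (Primrec.const 2))).div (lD.add (.const 1))
  -- D and U need not share vertices, so their difference is resampled on a uniform grid. Λ is 8
  -- times a Lipschitz constant of 2^(N+1)(U - D), and the numerator of its code, used as the grid
  -- parameter, keeps the error within 1/8.
  obtain ⟨Λ, hΛ, eΛ⟩ := ((PrimrecRat.const 8).mul ((PrimrecRat.const 2).pow
    (Primrec.succ.comp pN))).mul (lU.add lD)
  have pM : Primrec fun q => (Λ q).1 := Primrec.fst.comp hΛ
  obtain ⟨v, hv, ev⟩ : PrimrecRat fun p : (ℕ × PolyCode × PolyCode) × ℕ =>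
      2 ^ (p.1.1 + 1) * (p.1.2.2.evalRat (p.2 / ((Λ p.1).1 + 1)) -
        p.1.2.1.evalRat (p.2 / ((Λ p.1).1 + 1))) := by
    obtain ⟨r, hr, er⟩ : PrimrecRat fun p : (ℕ × PolyCode × PolyCode) × ℕ =>
        (p.2 : ℚ) / ((Λ p.1).1 + 1) :=
      (PrimrecRat.natCast Primrec.snd).div
        ((PrimrecRat.natCast (pM.comp Primrec.fst)).add (.const 1))
    refine ((PrimrecRat.const 2).pow (Primrec.succ.comp (pN.comp Primrec.fst))).mul
      (PrimrecRat.sub ?_ ?_)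
    · exact (PolyCode.primrecRat_evalRat.comp ((pU.comp Primrec.fst).pair hr)).of_eq
        fun p => by rw [er]
    · exact (PolyCode.primrecRat_evalRat.comp ((pD.comp Primrec.fst).pair hr)).of_eq
        fun p => by rw [er]
  refine ⟨fun q => (δ q, PolyCode.grid (Λ q).1 fun k => v (q, k)),
    hδ.pair (PolyCode.primrec_grid pM hv), fun N D U hD hU hDU hint => ?_⟩
  have lD0 : (0 : ℝ) ≤ D.lip := by exact_mod_cast D.lip_nonneg
  have lU0 : (0 : ℝ) ≤ U.lip := by exact_mod_cast U.lip_nonneg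
  have lD0' := D.lip_nonneg
  have hδ' : (δ (N, D, U)).val = (1 / 2) ^ (N + 2) / (D.lip + 1) := eδ _
  have hΛ' : (Λ (N, D, U)).val = 8 * 2 ^ (N + 1) * (U.lip + D.lip) := eΛ _
  set n := (Λ (N, D, U)).1 with hn
  have hn1 : 2 ^ (N + 1) * ((U.lip : ℝ) + D.lip) ≤ n / 8 := by
    have : (8 * 2 ^ (N + 1) * (U.lip + D.lip) : ℚ) ≤ n := hΛ' ▸ (Λ (N, D, U)).val_le_fst
    have : ((8 * 2 ^ (N + 1) * (U.lip + D.lip) : ℚ) : ℝ) ≤ (n : ℚ) := Rat.cast_le.2 this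
    push_cast at this
    linarith
  set F : ℝ → ℝ := fun x => 2 ^ (N + 1) * (U.eval x - D.eval x) with hFdef
  set w : ℕ → RatCode := fun k => v ((N, D, U), k) with hw
  have hwF : ∀ k, ((w k).val : ℝ) = F (k / (n + 1)) := fun k => by
    rw [hw, ev, hFdef]
    push_cast [PolyCode.cast_evalRat]
    rfl
  have hF : ∀ x ≤ 1, ∀ y ≤ 1, |F x - F y| ≤ (2 ^ (N + 1) * ((U.lip : ℝ) + D.lip)) * |x - y| := by
    intro x hx y hy
    have h1 := hU.abs_sub_le hx hy
    have h2 := hD.abs_sub_le hx hy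
    have h3 : F x - F y = 2 ^ (N + 1) * ((U.eval x - U.eval y) - (D.eval x - D.eval y)) := by
      simp only [hFdef]; ring
    rw [h3, abs_mul, abs_of_pos (by positivity), mul_assoc]
    refine mul_le_mul_of_nonneg_left ((abs_sub _ _).trans ?_) (by positivity)
    linarith
  have hG : ∀ x ∈ Icc (0 : ℝ) 1, |(PolyCode.grid n w).eval x - F x| ≤ 1 / 8 := fun x hx => by
    refine (PolyCode.abs_eval_grid_sub_le (by positivity) hF (fun k _ => hwF k) hx).trans ?_
    rw [div_le_iff₀ (by positivity)]
    linarith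
  have hpoly := PolyCode.isPolygonal_grid n w
  refine ⟨⟨?_, hpoly, ?_, ?_⟩, ?_, fun x hx => ?_⟩
  · rw [hδ']; positivity
  · rw [hpoly.nonneg_iff]
    intro u hu
    obtain ⟨k, hk, rfl⟩ := List.mem_map.1 hu
    have hk' : k ≤ n + 1 := by have := List.mem_range.1 hk; omega
    have hkn : (k : ℚ) ≤ n + 1 := by exact_mod_cast hk'
    have h0 : (k : ℚ) / (n + 1) ∈ Icc (0 : ℚ) 1 :=
      ⟨by positivity, (div_le_one (by positivity)).2 hkn⟩
    have h1 := hDU (.ofRat _ h0)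
    rw [UnitPoint.val_ofRat] at h1
    have h2 : (0 : ℝ) ≤ (w k).val := by
      rw [hwF]
      push_cast at h1
      exact mul_nonneg (by positivity) (sub_nonneg.2 h1)
    exact_mod_cast h2
  -- The integral is less than 2^(N+1) · 2^-(N+3) + 1/8 = 3/8.
  · have hFi : IntervalIntegrable F MeasureTheory.volume 0 1 :=
      (hU.intervalIntegrable.sub hD.intervalIntegrable).const_mul _
    have h1 : ∫ x in (0 : ℝ)..1, (PolyCode.grid n w).eval x ≤ ∫ x in (0 : ℝ)..1, (F x + 1 / 8) :=
      intervalIntegral.integral_mono_on zero_le_one hpoly.intervalIntegrable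
        (hFi.add intervalIntegrable_const) fun x hx => by
          linarith [(abs_le.1 (hG x hx)).2]
    rw [← hpoly.integral_eq, intervalIntegral.integral_add hFi intervalIntegrable_const, hFdef,
      intervalIntegral.integral_const_mul, intervalIntegral.integral_sub hU.intervalIntegrable
        hD.intervalIntegrable, ← hU.integral_eq, ← hD.integral_eq] at h1
    have h2 : ((U.integral - D.integral : ℚ) : ℝ) < ((1 / 2) ^ (N + 3) : ℚ) := Rat.cast_lt.2 hint
    push_cast at h2
    have h3 : (2 : ℝ) ^ (N + 1) * (1 / 2) ^ (N + 3) = 1 / 4 := by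
      rw [pow_add (1 / 2 : ℝ) N 3, pow_succ, mul_mul_mul_comm, ← mul_pow]; norm_num
    have h4 := mul_lt_mul_of_pos_left h2 (by positivity : (0 : ℝ) < 2 ^ (N + 1))
    rw [h3] at h4
    have h5 : (((PolyCode.grid n w).integral : ℚ) : ℝ) < ((1 / 2 : ℚ) : ℝ) := by
      push_cast
      norm_num at h1 h4 ⊢
      linarith
    exact_mod_cast h5
  · change (D.lip + 1) * (δ (N, D, U)).val = _
    rw [hδ', mul_div_cancel₀ _ (by positivity)]
  · linarith [(abs_le.1 (hG x hx)).1]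

theorem Construction.not_darbouxIntegrable_sum {A : ℕ → ℕ →. Output} (hA : IsNumbering A)
    (C : Construction A) : ¬ DarbouxIntegrable C.sum := by
  rintro ⟨φ, hφ, H⟩
  obtain ⟨ψ, hψ, hψ'⟩ := exists_primrec_rescaled_gap
  obtain ⟨ε, hε, eε⟩ := (PrimrecRat.const (α := ℕ) (1 / 2)).pow
    (Primrec.nat_add.comp Primrec.id (Primrec.const 3))
  -- This algorithm is to be applied to its own index.
  have hχ : Partrec fun N : ℕ => (φ (RealCode.ofRatCode (ε N))).map fun p => ψ (N, p) :=
    Partrec.map (hφ.comp (RealCode.primrec_ofRatCode.comp hε).to_comp) hψ.to_comp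
  obtain ⟨N, hN⟩ := hA.2 _ hχ
  obtain ⟨D, U, hDU, hD, hU, hf, hint⟩ := H (RealCode.ofRatCode (ε N)) (ε N).val
    (RealCode.represents_ofRatCode _) (by rw [eε]; push_cast; positivity)
  rw [Rat.cast_lt, eε] at hint
  obtain ⟨hadm, hδ, hG⟩ := hψ' N D U hD hU (fun x => (hf x).1.trans (hf x).2) hint
  have hmem : ψ (N, D, U) ∈ A N N := by
    rw [hN]; exact Part.mem_map (fun p => ψ (N, p)) hDU
  have hNr : N ∈ range C.μ := by rw [C.μ_range]; exact ⟨_, hmem, hadm⟩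
  obtain ⟨n, rfl⟩ := hNr
  have hres := Part.mem_unique (C.result n) hmem
  have hδn : C.δ n = (ψ (C.μ n, D, U)).1 := by rw [← hres]
  have hgn : C.g n = (ψ (C.μ n, D, U)).2 := by rw [← hres]
  rw [← hδn] at hδ
  rw [← hgn] at hG
  have hβ := C.β_pos n
  have hβ' := C.β_pos_real n
  have hβlt := C.β_lt n
  rw [lt_min_iff, lt_min_iff] at hβlt
  obtain ⟨hβδ, -, hβζ⟩ := hβlt
  have hζ := C.ζ_mem n
  let p : UnitPoint := .ofRat (C.ζ n).val ⟨hζ.1.le, hζ.2.le⟩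
  let q : UnitPoint := .ofRat ((C.ζ n).val + (C.β n).val) ⟨by linarith [hζ.1], by linarith⟩
  have hp1 : p.1 = ((C.ζ n).val : ℝ) := rfl
  have hq1 : q.1 = ((C.ζ n).val : ℝ) + (C.β n).val := Rat.cast_add _ _
  have hp : p.1 ∈ C.support n := by
    rw [hp1, support]; push_cast; constructor <;> linarith
  have hq : q.1 ∈ C.support n := by
    rw [hq1, support]; push_cast; constructor <;> linarith
  have fp : (1 / 2 : ℝ) ^ C.μ n ≤ C.sum p := by
    refine le_trans (le_of_eq ?_) (le_hasSum (C.hasSum_sum p) n fun k _ => C.bump_nonneg k _)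
    simp [bump, hp1]
  -- q is the end of the n-th bump, where that bump vanishes; every other bump vanishes there
  -- because the supports are disjoint.
  have fq : C.sum q = 0 := by
    refine (C.hasSum_sum q).unique ?_
    convert! hasSum_zero with k
    by_contra h0
    obtain rfl := C.eq_of_mem_support (C.mem_support_of_bump_ne_zero h0) hq
    refine h0 (C.bump_eq_zero ?_)
    rw [hq1, add_sub_cancel_left]
    exact le_abs_self _
  have hU1 := (hf p).2
  have hD1 := (hf q).1
  rw [fq] at hD1
  have hD2 := hD.abs_sub_le p.2.1.2 q.2.1.2
  have hpq : |p.1 - q.1| = (C.β n).val := by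
    rw [hp1, hq1, sub_add_cancel_left, abs_neg, abs_of_pos hβ']
  rw [hpq] at hD2
  have hsmall : (D.lip : ℝ) * (C.β n).val ≤ (1 / 2) ^ (C.μ n + 2) := by
    have : D.lip * (C.β n).val ≤ (1 / 2) ^ (C.μ n + 2) := by
      rw [← hδ]
      nlinarith [D.lip_nonneg]
    have : ((D.lip * (C.β n).val : ℚ) : ℝ) ≤ ((1 / 2) ^ (C.μ n + 2) : ℚ) := Rat.cast_le.2 this
    push_cast at this
    exact this
  have hG1 := hG p.1 p.2.1
  have hsep := (C.separation n p hp).1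
  have hh := C.h_nonneg (C.ν n) p
  -- U ≥ f ≥ 2^-μ(n) at p, while D ≤ f = 0 at q and D rises by at most 2^-μ(n)/4 from q to p.
  have h4 : (1 / 2 : ℝ) ^ C.μ n * (3 / 4) ≤ U.eval p.1 - D.eval p.1 := by
    rw [pow_add] at hsmall
    norm_num at hsmall fp ⊢
    linarith [(abs_le.1 hD2).2]
  -- Rescaled, the gap is at least 3/2, so g_n(p) ≥ 3/2 - 1/8 > 1, whereas separation and h ≥ 0 give
  -- g_n(p) < 1.
  have h5 := mul_le_mul_of_nonneg_left h4 (by positivity : (0 : ℝ) ≤ 2 ^ (C.μ n + 1))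
  have h6 : (2 : ℝ) ^ (C.μ n + 1) * ((1 / 2) ^ C.μ n * (3 / 4)) = 3 / 2 := by
    rw [pow_succ, mul_mul_mul_comm, ← mul_pow]; norm_num
  rw [h6] at h5
  linarith

/-! ### A singular sequence of polygonal functions -/

/-- Every cell of the refined grid lies in one coarse cell, where the function is affine. So
re-interpolation on the finer grid changes nothing, and inequalities between nodal values pass to
all points. -/
theorem PolyCode.eval_grid_refine {n₀ n d k : ℕ} (v : ℕ → RatCode) (hd : n + 1 = (n₀ + 1) * d)
    (hk : k ≤ n) {x : ℝ} (h1 : (k : ℝ) ≤ (n + 1) * x) (h2 : (n + 1) * x ≤ k + 1) :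
    (grid n₀ v).eval x = (grid n₀ v).eval ((k + 1 : ℕ) / (n + 1)) * ((n + 1) * x - k) +
      (grid n₀ v).eval (k / (n + 1)) * (k + 1 - (n + 1) * x) := by
  have d0 : 0 < d := Nat.pos_of_ne_zero fun h => by simp [h] at hd
  have hd' : ((n : ℝ) + 1) = (n₀ + 1) * d := by exact_mod_cast hd
  have dpos : (0 : ℝ) < d := by exact_mod_cast d0
  have hn : (0 : ℝ) < n₀ + 1 := by positivity
  have hK : k / d ≤ n₀ := Nat.lt_succ_iff.1 ((Nat.div_lt_iff_lt_mul d0).2 (by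
    rw [Nat.succ_eq_add_one, ← hd]; omega))
  have hK1 : ((k / d : ℕ) : ℝ) * d ≤ k := by exact_mod_cast Nat.div_mul_le_self k d
  have hK2 : (k : ℝ) + 1 ≤ ((k / d : ℕ) + 1) * d := by
    have : k + 1 ≤ (k / d + 1) * d := by
      have := Nat.lt_mul_of_div_lt (Nat.lt_succ_self (k / d)) d0
      rw [Nat.succ_eq_add_one] at this
      omega
    exact_mod_cast this
  rw [hd'] at h1 h2 ⊢
  have cell : ∀ y : ℝ, (k : ℝ) ≤ (n₀ + 1) * d * y → (n₀ + 1) * d * y ≤ k + 1 →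
      (grid n₀ v).eval y = (v (k / d + 1)).val * ((n₀ + 1) * y - (k / d : ℕ)) +
        (v (k / d)).val * ((k / d : ℕ) + 1 - (n₀ + 1) * y) := by
    intro y hy1 hy2
    refine eval_grid v hK ?_ ?_
    · refine le_of_mul_le_mul_right (a := (d : ℝ)) ?_ dpos
      linarith
    · refine le_of_mul_le_mul_right (a := (d : ℝ)) ?_ dpos
      linarith
  have e0 : ((n₀ : ℝ) + 1) * d * (k / ((n₀ + 1) * d)) = k := by field_simp
  have e1 : ((n₀ : ℝ) + 1) * d * ((k + 1 : ℕ) / ((n₀ + 1) * d)) = k + 1 := by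
    push_cast; field_simp
  rw [cell x h1 h2, cell _ e0.ge (by linarith), cell _ (by linarith) e1.le]
  push_cast
  field_simp
  ring

theorem integral_indicator_Icc_le (r η : ℝ) (hη : 0 ≤ η) :
    ∫ x in (0 : ℝ)..1, (Icc (r - η) (r + η)).indicator (fun _ => (2 : ℝ)) x ≤ 4 * η := by
  rw [intervalIntegral.integral_of_le zero_le_one, MeasureTheory.integral_indicator_const _
    measurableSet_Icc, smul_eq_mul, MeasureTheory.measureReal_restrict_apply measurableSet_Icc]
  have h := MeasureTheory.measureReal_mono (μ := MeasureTheory.volume)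
    (inter_subset_left (s := Icc (r - η) (r + η)) (t := Ioc (0 : ℝ) 1)) (by simp)
  rw [Real.volume_real_Icc_of_le (by linarith)] at h
  linarith

/-- Raising a function on a grid to the value `2` near the point `r`, at the cost of a small
increase of the integral, on a finer grid. -/
theorem PolyCode.exists_primrec_raise : ∃ T : ℕ × ℕ × RatCode × PolyCode → PolyCode, Primrec T ∧
    ∀ (n s : ℕ) (r : RatCode) (n₀ d : ℕ) (v : ℕ → RatCode), n + 1 = (n₀ + 1) * d →
      (∀ x ∈ Icc (0 : ℝ) 1, (grid n₀ v).eval x ∈ Icc (0 : ℝ) 2) →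
      (∃ w, T (n, s, r, grid n₀ v) = grid n w) ∧
      (∀ x ∈ Icc (0 : ℝ) 1, (T (n, s, r, grid n₀ v)).eval x ∈ Icc (0 : ℝ) 2) ∧
      (∀ x ∈ Icc (0 : ℝ) 1, (grid n₀ v).eval x ≤ (T (n, s, r, grid n₀ v)).eval x) ∧
      (∀ x ∈ Icc (0 : ℝ) 1, |x - r.val| ≤ (1 / 2) ^ s → (T (n, s, r, grid n₀ v)).eval x = 2) ∧
      ((T (n, s, r, grid n₀ v)).integral : ℝ) ≤
        (grid n₀ v).integral + 4 * ((1 / 2) ^ s + 2 / (n + 1)) := by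
  -- Nodes are raised up to one mesh width beyond 2^-s, so that both ends of any cell meeting the
  -- 2^-s-neighbourhood of r get the value 2.
  obtain ⟨W, hW, eW⟩ : PrimrecRat fun p : (ℕ × ℕ × RatCode × PolyCode) × ℕ =>
      max (p.1.2.2.2.evalRat (p.2 / (p.1.1 + 1)))
        (if |(p.2 : ℚ) / (p.1.1 + 1) - p.1.2.2.1.val| ≤ (1 / 2) ^ p.1.2.1 + 1 / (p.1.1 + 1)
          then 2 else 0) := by
    have pn : PrimrecRat fun p : (ℕ × ℕ × RatCode × PolyCode) × ℕ => (p.1.1 : ℚ) + 1 :=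
      (PrimrecRat.natCast (Primrec.fst.comp Primrec.fst)).add (.const 1)
    have py := (PrimrecRat.natCast (α := (ℕ × ℕ × RatCode × PolyCode) × ℕ) Primrec.snd).div pn
    have p2 : Primrec fun p : (ℕ × ℕ × RatCode × PolyCode) × ℕ => p.1.2 :=
      Primrec.snd.comp Primrec.fst
    have ps := (PrimrecRat.const (α := (ℕ × ℕ × RatCode × PolyCode) × ℕ) (1 / 2)).pow
      (Primrec.fst.comp p2)
    have pr := PrimrecRat.val (Primrec.fst.comp (Primrec.snd.comp p2))
    obtain ⟨y, hy, ey⟩ := id py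
    refine PrimrecRat.max ?_ (.ite ((py.sub pr).abs.le (ps.add ((PrimrecRat.const 1).div pn)))
      (.const 2) (.const 0))
    exact (PolyCode.primrecRat_evalRat.comp
      ((Primrec.snd.comp (Primrec.snd.comp p2)).pair hy)).of_eq fun p => by rw [ey]
  refine ⟨fun p => grid p.1 fun k => W (p, k), primrec_grid Primrec.fst hW,
    fun n s r n₀ d v hd hv => ?_⟩
  set H := grid n₀ v with hH
  set w : ℕ → RatCode := fun k => W ((n, s, r, H), k) with hw
  have hn : (0 : ℝ) < n + 1 := by positivity
  have ew : ∀ k, ((w k).val : ℝ) = max (H.eval (k / (n + 1)))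
      (if |(k : ℝ) / (n + 1) - r.val| ≤ (1 / 2) ^ s + 1 / (n + 1) then 2 else 0) := by
    intro k
    have h1 : (|(k : ℚ) / (n + 1) - r.val| ≤ (1 / 2) ^ s + 1 / (n + 1)) ↔
        (|(k : ℝ) / (n + 1) - r.val| ≤ (1 / 2) ^ s + 1 / (n + 1)) := by
      rw [← Rat.cast_le (K := ℝ)]; push_cast; exact Iff.rfl
    simp only [hw, eW, h1]
    push_cast [PolyCode.cast_evalRat]
    split_ifs <;> norm_num
  have grid_mem : ∀ k ≤ n + 1, (k : ℝ) / (n + 1) ∈ Icc (0 : ℝ) 1 := fun k hk => by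
    have : (k : ℝ) ≤ n + 1 := by exact_mod_cast hk
    exact ⟨by positivity, (div_le_one hn).2 this⟩
  have w_mem : ∀ k ≤ n + 1, ((w k).val : ℝ) ∈ Icc (0 : ℝ) 2 := by
    intro k hk
    have := hv _ (grid_mem k hk)
    rw [ew]
    refine ⟨le_max_of_le_left this.1, max_le this.2 ?_⟩
    split_ifs <;> norm_num
  have hpoly := isPolygonal_grid n w
  have bounds : ∀ x ∈ Icc (0 : ℝ) 1, (grid n w).eval x ∈ Icc (0 : ℝ) 2 := by
    intro x hx
    obtain ⟨k, hk, h1, h2⟩ := exists_cell n hx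
    rw [eval_grid w hk h1 h2]
    have := w_mem k (by omega)
    have := w_mem (k + 1) (by omega)
    simp only [mem_Icc] at *
    constructor <;> nlinarith
  have mono : ∀ x ∈ Icc (0 : ℝ) 1, H.eval x ≤ (grid n w).eval x := by
    intro x hx
    obtain ⟨k, hk, h1, h2⟩ := exists_cell n hx
    rw [eval_grid w hk h1 h2, hH, eval_grid_refine v hd hk h1 h2, ← hH, ew, ew]
    gcongr <;> exact le_max_left _ _
  have near : ∀ (x : ℝ) (k : ℕ), |(n + 1) * x - k| ≤ 1 → |x - k / (n + 1)| ≤ 1 / (n + 1) := by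
    intro x k h
    rw [le_div_iff₀ hn, ← abs_of_pos hn, ← abs_mul, abs_of_pos hn, sub_mul,
      div_mul_cancel₀ _ hn.ne', mul_comm x]
    exact h
  refine ⟨⟨w, rfl⟩, bounds, mono, fun x hx hxr => ?_, ?_⟩
  · obtain ⟨k, hk, h1, h2⟩ := exists_cell n hx
    have key : ∀ j ≤ n + 1, |(n + 1) * x - j| ≤ 1 → ((w j).val : ℝ) = 2 := by
      intro j hj h
      rw [ew, if_pos, max_eq_right (hv _ (grid_mem j hj)).2]
      have h3 := near x j h
      have h4 := abs_sub_le ((j : ℝ) / (n + 1)) x r.val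
      rw [abs_sub_comm] at h3
      linarith
    change (grid n w).eval x = 2
    rw [eval_grid w hk h1 h2, key k (by omega) (by rw [abs_le]; constructor <;> linarith),
      key (k + 1) (by omega) (by push_cast; rw [abs_le]; constructor <;> linarith)]
    ring
  -- The second mesh width ensures that at points further than η from r neither end of the cell is
  -- raised. The increase is thus at most 2 on an interval of length 2η.
  · set η : ℝ := (1 / 2) ^ s + 2 / (n + 1) with hη
    have η0 : 0 ≤ η := by positivity
    have hH1 : H.IsPolygonal := isPolygonal_grid n₀ v
    have le : ∀ x ∈ Icc (0 : ℝ) 1, (grid n w).eval x ≤ H.eval x +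
        (Icc ((r.val : ℝ) - η) (r.val + η)).indicator (fun _ => (2 : ℝ)) x := by
      intro x hx
      by_cases hxr : x ∈ Icc ((r.val : ℝ) - η) (r.val + η)
      · rw [indicator_of_mem hxr]
        linarith [(bounds x hx).2, (hv x hx).1]
      · rw [indicator_of_notMem hxr, add_zero]
        have far : η < |x - r.val| := by
          by_contra h
          rw [not_lt, abs_le] at h
          exact hxr ⟨by linarith, by linarith⟩
        obtain ⟨k, hk, h1, h2⟩ := exists_cell n hx
        have key : ∀ j ≤ n + 1, |(n + 1) * x - j| ≤ 1 →
            ((w j).val : ℝ) = H.eval (j / (n + 1)) := by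
          intro j hj h
          rw [ew, if_neg, max_eq_left (hv _ (grid_mem j hj)).1]
          have h3 := near x j h
          have h4 := abs_sub_le x ((j : ℝ) / (n + 1)) r.val
          have h5 : (2 : ℝ) / (n + 1) = 1 / (n + 1) + 1 / (n + 1) := by ring
          rw [not_le]
          linarith
        rw [eval_grid w hk h1 h2, key k (by omega) (by rw [abs_le]; constructor <;> linarith),
          key (k + 1) (by omega) (by push_cast; rw [abs_le]; constructor <;> linarith), hH,
          ← eval_grid_refine v hd hk h1 h2]
    have hI : IntervalIntegrable ((Icc ((r.val : ℝ) - η) (r.val + η)).indicator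
        fun _ => (2 : ℝ)) MeasureTheory.volume 0 1 := by
      rw [intervalIntegrable_iff_integrableOn_Ioc_of_le zero_le_one]
      exact (MeasureTheory.integrable_const (2 : ℝ)).indicator measurableSet_Icc
    have h3 := intervalIntegral.integral_mono_on zero_le_one hpoly.intervalIntegrable
      (hH1.intervalIntegrable.add hI) le
    rw [intervalIntegral.integral_add hH1.intervalIntegrable hI, ← hpoly.integral_eq,
      ← hH1.integral_eq] at h3
    exact h3.trans (add_le_add_right (integral_indicator_Icc_le _ _ η0) _)

/-- A computable enumeration of intervals, of small total length, which cover all constructive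
points: `r i` is within `2 ^ -(e i + s)` of the points with the code number `e i`. -/
theorem exists_singular_cover (s : ℕ) : ∃ (e : ℕ → ℕ) (r : ℕ → RatCode), Computable e ∧
    Computable r ∧ Function.Injective e ∧
    ∀ x : UnitPoint, ∃ i, |x.1 - (r i).val| ≤ (1 / 2) ^ (e i + s) := by
  -- Every j for which the approximation halts is enumerated, whether or not it codes a real;
  -- halting is semidecidable, and superfluous intervals only add to a convergent total length.
  let φ : ℕ →. RatCode := fun j => RealCode.approx (Denumerable.ofNat RealCode j, j + s)
  have hφ : Partrec φ := RealCode.partrec_approx.comp ((Computable.ofNat RealCode).pair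
    (Primrec.nat_add.comp Primrec.id (Primrec.const s)).to_comp)
  have hdom : ∀ (c : RealCode) (x : ℝ), c.Represents x →
      ∃ r ∈ φ (Encodable.encode c), |(r.val : ℝ) - x| ≤ (1 / 2) ^ (Encodable.encode c + s) := by
    intro c x hc
    simp only [φ, Denumerable.ofNat_encode]
    exact hc.exists_approx _
  have hinf : (Set.ofPred fun j => (φ j).Dom).Infinite := by
    refine Set.infinite_of_injective_forall_mem
      (f := fun k : ℕ => Encodable.encode (RealCode.ofRatCode (RatCode.ofNat k))) ?_ fun k => ?_
    · intro a b hab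
      have h1 := congrArg Prod.fst (Encodable.encode_injective hab)
      have h2 := Encodable.encode_injective (Nat.Partrec.Code.const_inj h1)
      exact congrArg Prod.fst h2
    · obtain ⟨r, hr, -⟩ := hdom _ _ (RealCode.represents_ofRatCode (RatCode.ofNat k))
      exact Part.dom_iff_mem.2 ⟨r, hr⟩
  obtain ⟨e, he, hinj, hrange⟩ := hφ.dom_re.exists_injective_enumeration hinf
  have hd : ∀ i, (φ (e i)).Dom := fun i => by
    have : e i ∈ Set.ofPred fun j => (φ j).Dom := hrange ▸ mem_range_self i
    exact this
  refine ⟨e, fun i => (φ (e i)).get (hd i), he,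
    (hφ.comp he).of_eq_tot fun i => Part.get_mem (hd i), hinj, fun x => ?_⟩
  obtain ⟨c, hc⟩ := x.2.2
  obtain ⟨q, hq, hqx⟩ := hdom c x.1 hc
  have : Encodable.encode c ∈ range e := by
    rw [hrange]; exact Part.dom_iff_mem.2 ⟨q, hq⟩
  obtain ⟨i, hi⟩ := this
  refine ⟨i, ?_⟩
  rw [← hi] at hq hqx
  change |x.1 - (((φ (e i)).get (hd i)).val : ℝ)| ≤ _
  rw [Part.get_eq_of_mem hq (hd i), abs_sub_comm]
  exact hqx

theorem sum_half_pow_le_two {e : ℕ → ℕ} (he : Function.Injective e) (n : ℕ) :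
    ∑ i ∈ Finset.range n, (1 / 2 : ℝ) ^ e i ≤ 2 := by
  calc ∑ i ∈ Finset.range n, (1 / 2 : ℝ) ^ e i
      = ∑ j ∈ (Finset.range n).image e, (1 / 2 : ℝ) ^ j := (Finset.sum_image he.injOn).symm
    _ ≤ ∑' j, (1 / 2 : ℝ) ^ j :=
        summable_geometric_two.sum_le_tsum _ fun _ _ => by positivity
    _ = 2 := tsum_geometric_two

/-- h_{i+1} raises h_i to 2 near r_i. Every constructive point is reached after finitely many steps,
and the costs, proportional to 2^-e(i) with e injective, stay summable. -/
theorem exists_singular_sequence : ∃ h : ℕ → PolyCode, Computable h ∧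
    (∀ n, (h n).IsPolygonal) ∧ (∀ n (x : UnitPoint), 0 ≤ (h n).eval x.1) ∧
    (∀ n (x : UnitPoint), (h n).eval x.1 ≤ (h (n + 1)).eval x.1) ∧
    (∀ x : UnitPoint, Tendsto (fun n => (h n).eval x.1) atTop (𝓝 2)) ∧
    ∀ n, (h n).integral < 1 / 2 := by
  obtain ⟨e, r, he, hr, hinj, hcover⟩ := exists_singular_cover 6
  obtain ⟨T, hT, hT'⟩ := PolyCode.exists_primrec_raise
  -- The i-th grid has `lev i + 1` cells. Multiplying this number by 2^(e i + 8) keeps the grids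
  -- nested and makes the new mesh at most 2^-(e i + 8).
  let lev : ℕ → ℕ := fun i => Nat.rec 0 (fun i l => (l + 1) * 2 ^ (e i + 8) - 1) i
  have hlev : Computable lev := by
    refine Computable.nat_rec (f := fun i : ℕ => i) (g := fun _ => 0)
      (h := fun _ q => (q.2 + 1) * 2 ^ (e q.1 + 8) - 1) Computable.id (Computable.const _) ?_
    have hpow : Primrec₂ ((· ^ ·) : ℕ → ℕ → ℕ) := Primrec₂.unpaired'.1 Nat.Primrec.pow
    have h1 : Computable fun p : ℕ × ℕ × ℕ => 2 ^ (e p.2.1 + 8) :=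
      hpow.to_comp.comp (Computable.const 2) (Primrec.nat_add.to_comp.comp
        (he.comp (Computable.fst.comp Computable.snd)) (Computable.const 8))
    have h2 : Computable fun p : ℕ × ℕ × ℕ => p.2.2 + 1 :=
      Computable.succ.comp (Computable.snd.comp Computable.snd)
    exact Primrec.nat_sub.to_comp.comp (Primrec.nat_mul.to_comp.comp h2 h1) (Computable.const 1)
  have lev_succ : ∀ i, lev (i + 1) + 1 = (lev i + 1) * 2 ^ (e i + 8) := fun i =>
    Nat.sub_add_cancel (Nat.succ_le_of_lt (by positivity))
  let h : ℕ → PolyCode := fun i => Nat.rec (PolyCode.grid 0 fun _ => RatCode.ofNat 0)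
    (fun i H => T (lev (i + 1), e i + 6, r i, H)) i
  have hh : Computable h := by
    refine Computable.nat_rec (f := fun i : ℕ => i)
      (g := fun _ => PolyCode.grid 0 fun _ => RatCode.ofNat 0)
      (h := fun _ q => T (lev (q.1 + 1), e q.1 + 6, r q.1, q.2)) Computable.id
      (Computable.const _) ?_
    have hi : Computable fun p : ℕ × ℕ × PolyCode => p.2.1 := Computable.fst.comp Computable.snd
    exact hT.to_comp.comp ((hlev.comp (Computable.succ.comp hi)).pair
      ((Primrec.nat_add.to_comp.comp (he.comp hi) (Computable.const 6)).pair
        ((hr.comp hi).pair (Computable.snd.comp Computable.snd))))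
  have inv : ∀ i, (∃ v, h i = PolyCode.grid (lev i) v) ∧
      ∀ x ∈ Icc (0 : ℝ) 1, (h i).eval x ∈ Icc (0 : ℝ) 2 := by
    intro i
    induction i with
    | zero =>
      refine ⟨⟨_, rfl⟩, fun x hx => ?_⟩
      obtain ⟨k, hk, h1, h2⟩ := PolyCode.exists_cell 0 hx
      change (PolyCode.grid 0 fun _ => RatCode.ofNat 0).eval x ∈ _
      rw [PolyCode.eval_grid _ hk h1 h2]
      simp [RatCode.val_ofNat]
    | succ i ih =>
      obtain ⟨⟨v, hv⟩, hb⟩ := ih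
      have := hT' (lev (i + 1)) (e i + 6) (r i) (lev i) _ v (lev_succ i) (hv ▸ hb)
      rw [← hv] at this
      exact ⟨this.1, this.2.1⟩
  have step : ∀ i, (∀ x ∈ Icc (0 : ℝ) 1, (h i).eval x ≤ (h (i + 1)).eval x) ∧
      (∀ x ∈ Icc (0 : ℝ) 1, |x - (r i).val| ≤ (1 / 2) ^ (e i + 6) → (h (i + 1)).eval x = 2) ∧
      ((h (i + 1)).integral : ℝ) ≤ (h i).integral +
        4 * ((1 / 2) ^ (e i + 6) + 2 / (lev (i + 1) + 1)) := by
    intro i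
    obtain ⟨⟨v, hv⟩, hb⟩ := inv i
    have := hT' (lev (i + 1)) (e i + 6) (r i) (lev i) _ v (lev_succ i) (hv ▸ hb)
    rw [← hv] at this
    exact this.2.2
  have poly : ∀ i, (h i).IsPolygonal := fun i => by
    obtain ⟨⟨v, hv⟩, -⟩ := inv i
    rw [hv]; exact PolyCode.isPolygonal_grid _ _
  refine ⟨h, hh, poly, fun n x => ((inv n).2 x.1 x.2.1).1, fun n x => (step n).1 x.1 x.2.1,
    fun x => ?_, fun n => ?_⟩
  · obtain ⟨i, hi⟩ := hcover x
    have h2 := (step i).2.1 x.1 x.2.1 hi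
    refine tendsto_const_nhds.congr' ((eventually_ge_atTop (i + 1)).mono fun n hn => ?_)
    refine le_antisymm ?_ ((inv n).2 x.1 x.2.1).2
    rw [← h2]
    exact monotone_nat_of_le_succ (f := fun n => (h n).eval x.1)
      (fun n => (step n).1 x.1 x.2.1) hn
  -- 3/32 = 4 (1/64 + 2/256), the cost of one step per 2^-e(i); the sum of these powers is at most
  -- 2, so the integrals stay within 3/16.
  · have bound : ((h n).integral : ℝ) ≤
        3 / 32 * ∑ i ∈ Finset.range n, (1 / 2 : ℝ) ^ e i := by
      induction n with
      | zero =>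
        have : (h 0).integral = 0 := by
          change (PolyCode.grid 0 fun _ => RatCode.ofNat 0).integral = 0
          simp [PolyCode.grid, List.range_succ, PolyCode.integral, RatCode.val_ofNat]
        simp [this]
      | succ i ih =>
        refine (step i).2.2.trans ?_
        rw [Finset.sum_range_succ]
        have h1 : (2 : ℝ) ^ (e i + 8) ≤ lev (i + 1) + 1 := by
          have : 2 ^ (e i + 8) ≤ lev (i + 1) + 1 := by
            rw [lev_succ]; exact Nat.le_mul_of_pos_left _ (Nat.succ_pos _)
          exact_mod_cast this
        have h2 : (2 : ℝ) / (lev (i + 1) + 1) ≤ 2 * (1 / 2) ^ (e i + 8) := by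
          rw [one_div, inv_pow, ← div_eq_mul_inv]
          gcongr
        have h3 : (1 / 2 : ℝ) ^ (e i + 6) = (1 / 2) ^ e i * (1 / 64) := by
          rw [pow_add]; norm_num
        have h4 : (1 / 2 : ℝ) ^ (e i + 8) = (1 / 2) ^ e i * (1 / 256) := by
          rw [pow_add]; norm_num
        rw [h4] at h2
        rw [h3]
        linarith
    have h1 := sum_half_pow_le_two hinj n
    have h2 : ((h n).integral : ℝ) < ((1 / 2 : ℚ) : ℝ) := by
      push_cast; linarith
    exact_mod_cast h2

/-! ### Existence of the construction -/

theorem IsNumbering.exists_enumeration {A : ℕ → ℕ →. Output} (hA : IsNumbering A) :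
    ∃ μ : ℕ → ℕ, Computable μ ∧ Function.Injective μ ∧
      range μ = {N | ∃ o ∈ A N N, Output.Admissible o} := by
  have hre : REPred fun N => ∃ o ∈ A N N, Output.Admissible o :=
    REPred.exists_mem (P := fun q : ℕ × Output => q.2.Admissible)
      (hA.1.comp Computable.id Computable.id)
      (Output.primrecPred_admissible.comp_computable Computable.snd).to_re
  refine hre.exists_injective_enumeration ?_
  -- Constant algorithms with pairwise different admissible outputs have different indices, so the
  -- set to be enumerated is infinite.
  let o : ℕ → Output := fun k =>
    (RatCode.ofNat (k + 1), PolyCode.grid 0 fun _ => RatCode.ofNat 0)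
  have hadm : ∀ k, (o k).Admissible := fun k => by
    have hp := PolyCode.isPolygonal_grid 0 fun _ => RatCode.ofNat 0
    refine ⟨?_, hp, hp.nonneg_iff.2 fun v hv => ?_, ?_⟩
    · change 0 < (RatCode.ofNat (k + 1)).val
      rw [RatCode.val_ofNat]; positivity
    · obtain ⟨j, -, rfl⟩ := List.mem_map.1 hv
      exact (RatCode.val_ofNat 0).ge.trans' (by norm_num)
    · change (PolyCode.grid 0 fun _ => RatCode.ofNat 0).integral < _
      simp [PolyCode.grid, List.range_succ, PolyCode.integral, RatCode.val_ofNat]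
  have hex : ∀ k, ∃ N, A N = fun _ => Part.some (o k) := fun k =>
    hA.2 _ (Computable.const (o k)).partrec
  choose N hN using hex
  refine Set.infinite_of_injective_forall_mem (f := N) (fun a b hab => ?_) fun k =>
    ⟨o k, by rw [hN]; exact Part.mem_some _, hadm k⟩
  have h1 : (fun _ : ℕ => Part.some (o a)) = fun _ => Part.some (o b) := by
    rw [← hN, ← hN, hab]
  have h2 : o a = o b := Part.some_inj.1 (congrFun h1 0)
  have h3 : a + 1 = b + 1 := congrArg (fun o : Output => o.1.1) h2
  omega

/-- G + H has mean below 1 and is therefore below 1 somewhere; by the Lipschitz bound this persists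
at a nearby rational in the open interval. -/
theorem PolyCode.IsPolygonal.exists_rat_add_lt_one {G H : PolyCode} (hG : G.IsPolygonal)
    (hH : H.IsPolygonal) (iG : G.integral < 1 / 2) (iH : H.integral < 1 / 2) :
    ∃ q ∈ Ioo (0 : ℚ) 1, G.evalRat q + H.evalRat q < 1 := by
  obtain ⟨x, hx, hlt⟩ : ∃ x ∈ Icc (0 : ℝ) 1, G.eval x + H.eval x < 1 := by
    by_contra! hge
    have h1 := intervalIntegral.integral_mono_on zero_le_one intervalIntegrable_const
      (hG.intervalIntegrable.add hH.intervalIntegrable) hge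
    rw [intervalIntegral.integral_add hG.intervalIntegrable hH.intervalIntegrable,
      ← hG.integral_eq, ← hH.integral_eq, intervalIntegral.integral_const] at h1
    have h2 : (G.integral : ℝ) < ((1 / 2 : ℚ) : ℝ) := Rat.cast_lt.2 iG
    have h3 : (H.integral : ℝ) < ((1 / 2 : ℚ) : ℝ) := Rat.cast_lt.2 iH
    norm_num at h1 h2 h3
    linarith
  have hK : (0 : ℝ) ≤ G.lip + H.lip := by
    exact_mod_cast add_nonneg G.lip_nonneg H.lip_nonneg
  set K : ℝ := G.lip + H.lip with hKdef
  set η : ℝ := (1 - (G.eval x + H.eval x)) / (K + 1) with hη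
  have η0 : 0 < η := div_pos (by linarith) (by linarith)
  obtain ⟨q, h1, h2⟩ := exists_rat_btwn (show max 0 (x - η) < min 1 (x + η) by
    rw [max_lt_iff, lt_min_iff, lt_min_iff]
    refine ⟨⟨zero_lt_one, ?_⟩, ?_, ?_⟩ <;> linarith [hx.1, hx.2])
  rw [max_lt_iff] at h1
  rw [lt_min_iff] at h2
  refine ⟨q, ⟨by exact_mod_cast h1.1, by exact_mod_cast h2.1⟩, ?_⟩
  have hq : |(q : ℝ) - x| < η := by rw [abs_lt]; constructor <;> linarith
  have h3 := hG.abs_sub_le h2.1.le hx.2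
  have h4 := hH.abs_sub_le h2.1.le hx.2
  have h5 : K * |(q : ℝ) - x| ≤ K * η := mul_le_mul_of_nonneg_left hq.le hK
  have h6 : (K + 1) * η = 1 - (G.eval x + H.eval x) := mul_div_cancel₀ _ (by linarith)
  have h7 : ((G.evalRat q + H.evalRat q : ℚ) : ℝ) < ((1 : ℚ) : ℝ) := by
    push_cast [PolyCode.cast_evalRat]
    rw [hKdef] at h5 h6
    linarith [(abs_le.1 h3).2, (abs_le.1 h4).2]
  exact_mod_cast h7

/-- The requirement on the next centre `ζ`, half-width `β` and index `m`, given `δ`, `g` and the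
polygonal functions `H₀`, `H₁` with the indices `m₀`, `m`. -/
def SeparationData (q : (ℕ × RatCode × PolyCode × PolyCode) × (RatCode × RatCode × ℕ) × PolyCode) :
    Prop :=
  q.1.1 < q.2.1.2.2 ∧ 0 < q.2.1.1.val ∧ q.2.1.1.val < 1 ∧ 0 < q.2.1.2.1.val ∧
    q.2.1.2.1.val < min q.1.2.1.val (min q.2.1.1.val (1 - q.2.1.1.val)) ∧
    q.1.2.2.1.evalRat q.2.1.1.val + q.1.2.2.2.evalRat q.2.1.1.val +
      (q.1.2.2.1.lip + q.1.2.2.2.lip) * q.2.1.2.1.val < 1 ∧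
    1 + q.2.2.lip * q.2.1.2.1.val < q.2.2.evalRat q.2.1.1.val

theorem primrecPred_separationData : PrimrecPred SeparationData := by
  have p1 : Primrec fun q : (ℕ × RatCode × PolyCode × PolyCode) ×
    (RatCode × RatCode × ℕ) × PolyCode => q.1 := Primrec.fst
  have p21 : Primrec fun q : (ℕ × RatCode × PolyCode × PolyCode) ×
    (RatCode × RatCode × ℕ) × PolyCode => q.2.1 := Primrec.fst.comp Primrec.snd
  have p22 : Primrec fun q : (ℕ × RatCode × PolyCode × PolyCode) ×
    (RatCode × RatCode × ℕ) × PolyCode => q.2.2 := Primrec.snd.comp Primrec.snd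
  have m₀ := Primrec.fst.comp p1
  have δ := PrimrecRat.val (Primrec.fst.comp (Primrec.snd.comp p1))
  have g := Primrec.fst.comp (Primrec.snd.comp (Primrec.snd.comp p1))
  have H₀ := Primrec.snd.comp (Primrec.snd.comp (Primrec.snd.comp p1))
  have z := Primrec.fst.comp p21
  have ζ := PrimrecRat.val z
  have β := PrimrecRat.val (Primrec.fst.comp (Primrec.snd.comp p21))
  have m := Primrec.snd.comp (Primrec.snd.comp p21)
  have E := PolyCode.primrecRat_evalRat
  have L := PolyCode.primrecRat_lip
  have c1 := Primrec.nat_lt.comp m₀ m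
  have c2 := (PrimrecRat.const 0).lt ζ
  have c3 := ζ.lt (.const 1)
  have c4 := (PrimrecRat.const 0).lt β
  have c5 := β.lt (δ.min (ζ.min ((PrimrecRat.const 1).sub ζ)))
  have c6 := (((E.comp (g.pair z)).add (E.comp (H₀.pair z))).add
    (((L.comp g).add (L.comp H₀)).mul β)).lt (.const 1)
  have c7 := ((PrimrecRat.const 1).add ((L.comp p22).mul β)).lt (E.comp (p22.pair z))
  exact (c1.and (c2.and (c3.and (c4.and (c5.and (c6.and c7)))))).of_eq fun q => Iff.rfl

/-- The integrals supply ζ, the limit 2 at ζ supplies m, and β is chosen small against both gaps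
divided by the Lipschitz constants. -/
theorem exists_separationData {δ : RatCode} {g : PolyCode} (hadm : Output.Admissible (δ, g))
    {h : ℕ → PolyCode} (poly : ∀ n, (h n).IsPolygonal)
    (tends : ∀ x : UnitPoint, Tendsto (fun n => (h n).eval x.1) atTop (𝓝 2))
    (int : ∀ n, (h n).integral < 1 / 2) (m₀ : ℕ) :
    ∃ b : RatCode × RatCode × ℕ, SeparationData ((m₀, δ, g, h m₀), b, h b.2.2) := by
  obtain ⟨δ0, hg, -, ig⟩ := hadm
  simp only at δ0 hg ig
  obtain ⟨ζ, hζ, hlt⟩ := hg.exists_rat_add_lt_one (poly m₀) ig (int m₀)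
  obtain ⟨m, hm1, hm⟩ : ∃ m, 1 < (h m).evalRat ζ ∧ m₀ < m := by
    have h1 := (tends (.ofRat ζ ⟨hζ.1.le, hζ.2.le⟩)).eventually
      (lt_mem_nhds (by norm_num : (1 : ℝ) < 2))
    obtain ⟨m, h2, h3⟩ := (h1.and (eventually_gt_atTop m₀)).exists
    refine ⟨m, ?_, h3⟩
    change 1 < (h m).eval (ζ : ℝ) at h2
    rw [← PolyCode.cast_evalRat] at h2
    exact_mod_cast h2
  have lg := g.lip_nonneg
  have l₀ := (h m₀).lip_nonneg
  have l₁ := (h m).lip_nonneg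
  set K := g.lip + (h m₀).lip with hK
  set a := 1 - (g.evalRat ζ + (h m₀).evalRat ζ) with ha
  set b := (h m).evalRat ζ - 1 with hb
  obtain ⟨β, β0, hβ⟩ := exists_between (show (0 : ℚ) < min (min δ.val (min ζ (1 - ζ)))
      (min (a / (K + 1)) (b / ((h m).lip + 1))) by
    simp only [lt_min_iff]
    refine ⟨⟨δ0, hζ.1, by linarith [hζ.2]⟩, div_pos (by linarith) (by linarith),
      div_pos (by linarith) (by linarith)⟩)
  obtain ⟨hβ1, hβ⟩ := lt_min_iff.1 hβ
  obtain ⟨hβ2, hβ3⟩ := lt_min_iff.1 hβ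
  rw [lt_div_iff₀ (by linarith)] at hβ2 hβ3
  obtain ⟨z, rfl⟩ := RatCode.exists_val_eq ζ
  obtain ⟨w, rfl⟩ := RatCode.exists_val_eq β
  refine ⟨(z, w, m), hm, hζ.1, hζ.2, β0, hβ1, ?_, ?_⟩
  · simp only [← hK]; linarith
  · simp only; linarith

/-- The Lipschitz margins spread the inequalities from ζ to the whole interval. Hence a decidable
condition at one rational point suffices. -/
theorem SeparationData.separates {m₀ m : ℕ} {δ ζ β : RatCode} {g H₀ H₁ : PolyCode}
    (h : SeparationData ((m₀, δ, g, H₀), (ζ, β, m), H₁)) (hg : g.IsPolygonal)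
    (hH₀ : H₀.IsPolygonal) (hH₁ : H₁.IsPolygonal) {x : ℝ} (hx1 : x ≤ 1)
    (hx : x ∈ Icc ((ζ.val - β.val : ℚ) : ℝ) ((ζ.val + β.val : ℚ) : ℝ)) :
    g.eval x + H₀.eval x < 1 ∧ 1 < H₁.eval x := by
  obtain ⟨-, -, hζ, -, -, h1, h2⟩ := h
  simp only at hζ h1 h2
  have hζ' : (ζ.val : ℝ) ≤ 1 := by exact_mod_cast hζ.le
  have hd : |x - ζ.val| ≤ β.val := by
    obtain ⟨h1, h2⟩ := hx
    push_cast at h1 h2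
    rw [abs_le]; constructor <;> linarith
  have bound : ∀ L : PolyCode, L.IsPolygonal → |L.eval x - L.eval ζ.val| ≤ L.lip * β.val :=
    fun L hL => (hL.abs_sub_le hx1 hζ').trans
      (mul_le_mul_of_nonneg_left hd (by exact_mod_cast L.lip_nonneg))
  have h1' := (Rat.cast_lt (K := ℝ)).2 h1
  have h2' := (Rat.cast_lt (K := ℝ)).2 h2
  push_cast [PolyCode.cast_evalRat] at h1' h2'
  have b1 := abs_le.1 (bound g hg)
  have b2 := abs_le.1 (bound H₀ hH₀)
  have b3 := abs_le.1 (bound H₁ hH₁)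
  constructor <;> linarith [b1.2, b2.2, b3.1]

theorem nonempty_construction {A : ℕ → ℕ →. Output} (hA : IsNumbering A) :
    Nonempty (Construction A) := by
  obtain ⟨μ, hμ, hinj, hrange⟩ := hA.exists_enumeration
  obtain ⟨h, hh, poly, nonneg, mono, tends, int⟩ := exists_singular_sequence
  have hadm : ∀ n, ∃ o ∈ A (μ n) (μ n), Output.Admissible o := fun n => by
    have : μ n ∈ {N | ∃ o ∈ A N N, Output.Admissible o} := hrange ▸ mem_range_self n
    exact this
  choose o ho hoa using hadm
  have hoc : Computable o :=
    Partrec.of_eq_tot (f := fun n => A (μ n) (μ n)) (hA.1.comp hμ hμ) ho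
  let P : (ℕ × ℕ) × (RatCode × RatCode × ℕ) → Prop := fun q =>
    SeparationData ((q.1.2, (o q.1.1).1, (o q.1.1).2, h q.1.2), q.2, h q.2.2.2)
  have hP : ComputablePred P := by
    have c1 : Computable fun q : (ℕ × ℕ) × (RatCode × RatCode × ℕ) => o q.1.1 :=
      hoc.comp (Computable.fst.comp Computable.fst)
    have c2 : Computable fun q : (ℕ × ℕ) × (RatCode × RatCode × ℕ) => q.1.2 :=
      Computable.snd.comp Computable.fst
    exact primrecPred_separationData.comp_computable ((c2.pair ((Computable.fst.comp c1).pair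
      ((Computable.snd.comp c1).pair (hh.comp c2)))).pair (Computable.snd.pair
        (hh.comp (Computable.snd.comp (Computable.snd.comp Computable.snd)))))
  -- The requirement is decidable and satisfiable for every pair (n, m₀), so the search is total
  -- even though only the pairs (n, ν n) are used.
  obtain ⟨F, hF, hFP⟩ := hP.exists_computable_choice fun q =>
    exists_separationData (hoa q.1) poly tends int q.2
  let ν : ℕ → ℕ := fun n => Nat.rec 0 (fun n m => (F (n, m)).2.2) n
  have hν : Computable ν := Computable.nat_rec (f := fun n : ℕ => n) (g := fun _ => 0)
    (h := fun _ q => (F q).2.2) Computable.id (Computable.const _)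
    (Computable.snd.comp (Computable.snd.comp (hF.comp Computable.snd)))
  have key : ∀ n, SeparationData ((ν n, (o n).1, (o n).2, h (ν n)),
      F (n, ν n), h (ν (n + 1))) := fun n => hFP (n, ν n)
  have hFν : Computable fun n => F (n, ν n) := hF.comp (Computable.id.pair hν)
  exact ⟨{
    μ := μ
    μ_computable := hμ
    μ_injective := hinj
    μ_range := hrange
    δ := fun n => (o n).1
    g := fun n => (o n).2
    result := ho
    h := h
    h_computable := hh
    h_polygonal := poly
    h_nonneg := nonneg
    h_mono := mono
    h_tendsto := tends
    h_integral := int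
    ν := ν
    ν_computable := hν
    ν_strictMono := strictMono_nat_of_lt_succ fun n => (key n).1
    ζ := fun n => (F (n, ν n)).1
    ζ_computable := Computable.fst.comp hFν
    ζ_mem := fun n => ⟨(key n).2.1, (key n).2.2.1⟩
    β := fun n => (F (n, ν n)).2.1
    β_computable := Computable.fst.comp (Computable.snd.comp hFν)
    β_pos := fun n => (key n).2.2.2.1
    β_lt := fun n => (key n).2.2.2.2.1
    separation := fun n x hx =>
      (key n).separates (hoa n).2.1 (poly _) (poly _) x.2.1.2 hx }⟩

end MarkovAnalysis

theorem mainTheorem1 (A : ℕ → ℕ →. MarkovAnalysis.Output) (hA : MarkovAnalysis.IsNumbering A) :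
    Nonempty (MarkovAnalysis.Construction A) ∧
    ∀ C : MarkovAnalysis.Construction A, ∃ f : MarkovAnalysis.UnitPoint → ℝ,
      MarkovAnalysis.IsConstructiveFunction f ∧
      (∀ x : MarkovAnalysis.UnitPoint, HasSum (fun k => C.bump k x.1) (f x)) ∧
      ¬ MarkovAnalysis.DarbouxIntegrable f :=
  ⟨MarkovAnalysis.nonempty_construction hA, fun C =>
    ⟨C.sum, C.isConstructiveFunction_sum, C.hasSum_sum, C.not_darbouxIntegrable_sum hA⟩⟩
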